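/- Let $G$ be a connected and simply connected compact Lie group whose Lie algebra $\mathcal G$ is simple, and let $\langle X,Y\rangle = c\,\mathrm{tr}(\mathrm{ad}_X\circ\mathrm{ad}_Y)$ with a fixed constant $c>0$. Fix a maximal torus $G_0<G$ with Lie algebra $\mathcal G_0$ and normalizer $\mathfrak N$, and let $\mathcal G_\perp$ be the orthogonal complement of $\mathcal G_0$. An element of $\mathcal G$ is regular if its centralizer in $\mathcal G$ is the Lie algebra of a maximal torus; $\mathcal G^{\rm reg}$ is the open set of regular elements and $\mathcal G_0^{\rm reg}=\mathcal G_0\cap\mathcal G^{\rm reg}$. Then $\langle\cdot,\cdot\rangle$ is negative definite, $\mathcal G=\mathcal G_0\oplus\mathcal G_\perp$, and for every $\lambda\in\mathcal G_0^{\rm reg}$ the map $\mathrm{ad}_\lambda$ restricts to a bijection of $\mathcal G_\perp$, so that $r(\lambda)X:=(\mathrm{ad}_\lambda|_{\mathcal G_\perp})^{-1}(X_\perp)$ is well defined on $\mathcal G$, where $X=X_0+X_\perp$ with $X_0\in\mathcal G_0$, $X_\perp\in\mathcal G_\perp$. Identify $T^*G$ with $G\times\mathcal G$ by right translations and $\langle\cdot,\cdot\rangle$,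 with its canonical Poisson bracket $$\{\mathcal F,\mathcal H\}(g,J)=\langle\nabla_1\mathcal F,d_2\mathcal H\rangle-\langle\nabla_1\mathcal H,d_2\mathcal F\rangle+\langle J,[d_2\mathcal F,d_2\mathcal H]\rangle .$$ Here the derivatives are taken at $(g,J)$ and are defined by $\langle X,\nabla_1\mathcal F(g,J)\rangle=\frac{d}{dt}\big|_{t=0}\mathcal F(e^{tX}g,J)$, $\langle X,\nabla_1'\mathcal F(g,J)\rangle=\frac{d}{dt}\big|_{t=0}\mathcal F(ge^{tX},J)$ and $\langle X,d_2\mathcal F(g,J)\rangle=\frac{d}{dt}\big|_{t=0}\mathcal F(g,J+tX)$ for all $X\in\mathcal G$. For functions $F$ on $G\times\mathcal G_0^{\rm reg}$, $\nabla_1F,\nabla_1'F\in\mathcal G$ are defined in the same way, and $d_2F(g,\lambda)\in\mathcal G_0$ by $\langle X_0,d_2F(g,\lambda)\rangle=\frac{d}{dt}\big|_{t=0}F(g,\lambda+tX_0)$ for all $X_0\in\mathcal G_0$. Let $G$ act on $G\times\mathcal G$ by $\eta\cdot(g,J)=(\eta g\eta^{-1},\mathrm{Ad}_\eta J)$, and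 let the functions $F,H\in C^\infty(G\times\mathcal G_0^{\rm reg})^{\mathfrak N}$ be the restrictions of the functions $\mathcal F,\mathcal H\in C^\infty(G\times\mathcal G^{\rm reg})^G$. Define the reduced Poisson bracket by $\{F,H\}'_{\rm red}(g,\lambda):=\{\mathcal F,\mathcal H\}(g,\lambda)$ for $(g,\lambda)\in G\times\mathcal G_0^{\rm reg}$. Then, for all $(g,\lambda)\in G\times\mathcal G_0^{\rm reg}$, $$\{F,H\}'_{\rm red}(g,\lambda)=\langle\nabla_1F,d_2H\rangle-\langle\nabla_1H,d_2F\rangle+\langle\nabla_1'F,r(\lambda)\nabla_1'H\rangle-\langle\nabla_1F,r(\lambda)\nabla_1H\rangle ,$$ where the derivatives are taken at $(g,\lambda)$. -/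

import Mathlib

open scoped Manifold ContDiff

namespace CotangentReduction

instance instLEInftyMinSmoothness : ENat.LEInfty (minSmoothness ℝ 3) :=
  ⟨by rw [minSmoothness_of_isRCLikeNormedField]; exact ENat.LEInfty.out⟩

/-- The Lie algebra of a Lie group `G` modelled on `E`: the tangent space at the identity, with
Mathlib's bracket (the one of left-invariant vector fields; for matrix groups it is `XY - YX`). -/
abbrev LieAlg (E G : Type*) [NormedAddCommGroup E] [NormedSpace ℝ E] [TopologicalSpace G]
    [ChartedSpace E G] [Group G] := GroupLieAlgebra 𝓘(ℝ, E) G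

section Basic

variable {E G : Type*} [NormedAddCommGroup E] [NormedSpace ℝ E] [TopologicalSpace G]
  [ChartedSpace E G] [Group G]

/-- The Lie algebra is, as a vector space, the model space `E`; it inherits the norm of `E`, with
the algebraic and topological structure that Mathlib puts on tangent spaces. The norm only serves
to speak of smooth functions on the Lie algebra. -/
noncomputable instance instNormedAddCommGroupLieAlg : NormedAddCommGroup (LieAlg E G) :=
  { (inferInstance : AddCommGroup (LieAlg E G)),
    @MetricSpace.replaceTopology (LieAlg E G) inferInstance
      (inferInstanceAs (MetricSpace E)) rfl with
    norm := fun X => @norm E _ X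
    dist_eq := fun X Y => @NormedAddGroup.dist_eq E _ X Y }

noncomputable instance instNormedSpaceLieAlg : NormedSpace ℝ (LieAlg E G) :=
  { norm_smul_le := fun c X => @NormedSpace.norm_smul_le ℝ E _ _ _ c X }

instance instFiniteDimensionalLieAlg [FiniteDimensional ℝ E] :
    FiniteDimensional ℝ (LieAlg E G) := inferInstanceAs (FiniteDimensional ℝ E)

/-- The adjoint action of `η ∈ G` on the Lie algebra: the derivative at the identity of
`x ↦ η x η⁻¹`. -/
noncomputable def Ad (η : G) (X : LieAlg E G) : LieAlg E G :=
  mfderiv 𝓘(ℝ, E) 𝓘(ℝ, E) (fun x : G => η * x * η⁻¹) 1 X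

/-- `γ` is the smooth one-parameter subgroup `t ↦ exp (t X)` of `G` with initial velocity `X`. -/
structure IsOneParam (γ : ℝ → G) (X : LieAlg E G) : Prop where
  smooth : ContMDiff 𝓘(ℝ, ℝ) 𝓘(ℝ, E) ∞ γ
  map_add : ∀ s t, γ (s + t) = γ s * γ t
  velocity : (mfderiv 𝓘(ℝ, ℝ) 𝓘(ℝ, E) γ 0 (1 : ℝ) : E) = X

/-- Differentiating along `t ↦ exp (t X)` is the same as applying the derivative at `1` to `X`. -/
theorem deriv_oneParam {γ : ℝ → G} {X : LieAlg E G} (h : IsOneParam γ X) (f : G → ℝ)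
    (hf : MDifferentiableAt 𝓘(ℝ, E) 𝓘(ℝ, ℝ) f 1) :
    deriv (fun t => f (γ t)) 0 = (mfderiv 𝓘(ℝ, E) 𝓘(ℝ, ℝ) f 1 X : ℝ) := by
  have h0 : γ 0 = 1 := by simpa using h.map_add 0 0
  have hγ : MDifferentiableAt 𝓘(ℝ, ℝ) 𝓘(ℝ, E) γ 0 := h.smooth.mdifferentiable (by simp) 0
  rw [← h0] at hf
  have h2 := mfderiv_comp (I' := 𝓘(ℝ, E)) 0 hf hγ
  have e : mfderiv 𝓘(ℝ, ℝ) 𝓘(ℝ, ℝ) (f ∘ γ) 0 = fderiv ℝ (f ∘ γ) 0 := mfderiv_eq_fderiv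
  have h3 : deriv (f ∘ γ) 0 = (mfderiv 𝓘(ℝ, ℝ) 𝓘(ℝ, ℝ) (f ∘ γ) 0 (1 : ℝ) : ℝ) := by
    rw [e]
    exact fderiv_apply_one_eq_deriv.symm
  rw [h2] at h3
  refine h3.trans ?_
  have v := h.velocity
  change (mfderiv 𝓘(ℝ, E) 𝓘(ℝ, ℝ) f (γ 0) : E → ℝ)
    (mfderiv 𝓘(ℝ, ℝ) 𝓘(ℝ, E) γ 0 (1 : ℝ) : E) = _
  rw [v, h0]

variable (E) in
/-- The Lie algebra of a closed subgroup `T` of `G`, consisting of the `X` with `exp (t X) ∈ T` for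
all `t`. (For closed subgroups the set of these `X` is a linear subspace; the span only provides the
bundled subspace.) -/
noncomputable def subgroupLie (T : Subgroup G) : Submodule ℝ (LieAlg E G) :=
  Submodule.span ℝ {X | ∃ γ : ℝ → G, IsOneParam γ X ∧ ∀ t, γ t ∈ T}

variable (E) in
/-- `T` is a torus in `G`: the image of a smooth homomorphism `ℝᵏ → G` with kernel `ℤᵏ`, that is, of
an injective smooth homomorphism from the torus `ℝᵏ / ℤᵏ`. -/
def IsTorus (T : Subgroup G) : Prop :=
  ∃ (k : ℕ) (ψ : (Fin k → ℝ) → G),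
    ContMDiff 𝓘(ℝ, Fin k → ℝ) 𝓘(ℝ, E) ∞ ψ ∧ (∀ x y, ψ (x + y) = ψ x * ψ y) ∧
    (∀ x, ψ x = 1 ↔ ∀ i, ∃ m : ℤ, x i = m) ∧ Set.range ψ = T

variable (E) in
/-- A torus that is not properly contained in another one. -/
def IsMaximalTorus (T : Subgroup G) : Prop := Maximal (IsTorus E) T

variable (E G) in
/-- The regular elements of the Lie algebra: those whose centralizer in the Lie algebra is the Lie
algebra of a maximal torus. -/
def regularSet : Set (LieAlg E G) :=
  {J | ∃ T : Subgroup G, IsMaximalTorus E T ∧ ∀ X : LieAlg E G, X ∈ subgroupLie E T ↔ ⁅J, X⁆ = 0}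

/-- `C^∞(M'^reg)^G`: the function `Φ` is smooth on the open set
`M'^reg = {(g, J) | J regular} ⊆ G × Lie(G)` and invariant there under
`(g, J) ↦ (η g η⁻¹, Ad_η J)`. (Values of `Φ` off this set play no role.) -/
structure IsSmoothInvariant (Φ : G × LieAlg E G → ℝ) : Prop where
  smooth : ∀ p : G × LieAlg E G, p.2 ∈ regularSet E G →
    ContMDiffAt (𝓘(ℝ, E).prod 𝓘(ℝ, LieAlg E G)) 𝓘(ℝ, ℝ) ∞ Φ p
  invariant : ∀ (η : G) (p : G × LieAlg E G), p.2 ∈ regularSet E G →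
    Φ (η * p.1 * η⁻¹, Ad η p.2) = Φ p

/-- `C^∞(M'_0^reg)^N`: the function `F` is smooth on the open set
`M'_0^reg = {(g, Λ) | Λ regular} ⊆ G × Lie(G₀)` and invariant there under
`(g, Λ) ↦ (η g η⁻¹, Ad_η Λ)` for `η` in the normalizer of `G₀`. -/
structure IsSmoothNormalizerInvariant (G₀ : Subgroup G) (F : G × subgroupLie E G₀ → ℝ) :
    Prop where
  smooth : ∀ p : G × subgroupLie E G₀, (p.2 : LieAlg E G) ∈ regularSet E G →
    ContMDiffAt (𝓘(ℝ, E).prod 𝓘(ℝ, subgroupLie E G₀)) 𝓘(ℝ, ℝ) ∞ F p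
  invariant : ∀ η ∈ Subgroup.normalizer (G₀ : Set G), ∀ (g : G) (Λ Λ' : subgroupLie E G₀),
    (Λ : LieAlg E G) ∈ regularSet E G → (Λ' : LieAlg E G) = Ad η (Λ : LieAlg E G) →
    F (η * g * η⁻¹, Λ') = F (g, Λ)

/-- `F` is the restriction of `Φ` to `M'_0^reg`. -/
def IsRestriction (G₀ : Subgroup G) (F : G × subgroupLie E G₀ → ℝ) (Φ : G × LieAlg E G → ℝ) :
    Prop :=
  ∀ (g : G) (Λ : subgroupLie E G₀), (Λ : LieAlg E G) ∈ regularSet E G → F (g, Λ) = Φ (g, Λ)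

end Basic

section Gradient

/-- The vector `v` that represents the linear functional `φ` with respect to the bilinear form `B`:
`B X v = φ X` for all `X`. -/
noncomputable def rep {V : Type*} [AddCommGroup V] [Module ℝ V] (B : LinearMap.BilinForm ℝ V)
    (φ : V → ℝ) : V :=
  Classical.epsilon fun v => ∀ X, B X v = φ X

/-- For a nondegenerate symmetric form the representing vector exists and is unique. -/
theorem rep_eq_iff {V : Type*} [AddCommGroup V] [Module ℝ V] [FiniteDimensional ℝ V]
    (B : LinearMap.BilinForm ℝ V) (hB : B.Nondegenerate) (hs : B.IsSymm) (φ : V →ₗ[ℝ] ℝ) (v : V) :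
    rep B φ = v ↔ ∀ X, B X v = φ X := by
  have ex : ∃ v, ∀ X, B X v = φ X :=
    ⟨(B.toDual hB).symm φ, fun X => by
      rw [← hs.eq]; exact LinearMap.BilinForm.apply_toDual_symm_apply φ X⟩
  have spec : ∀ X, B X (rep B φ) = φ X := Classical.epsilon_spec ex
  refine ⟨fun h => h ▸ spec, fun h => ?_⟩
  have : (B.toDual hB) (rep B φ) = B.toDual hB v := by
    ext X
    rw [LinearMap.BilinForm.toDual_def, LinearMap.BilinForm.toDual_def, ← hs.eq]
    exact (spec X).trans ((h X).symm.trans (hs.eq v X).symm)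
  exact (B.toDual hB).injective this

end Gradient

section Bracket

variable {E G : Type*} [NormedAddCommGroup E] [NormedSpace ℝ E] [CompleteSpace E]
  [TopologicalSpace G] [ChartedSpace E G] [Group G] [LieGroup 𝓘(ℝ, E) ∞ G]

variable (E G) in
/-- The invariant inner product `⟨X, Y⟩ = c tr(ad_X ad_Y)`, a multiple of the Killing form. -/
noncomputable def form (c : ℝ) : LinearMap.BilinForm ℝ (LieAlg E G) :=
  c • killingForm ℝ (LieAlg E G)

/-- The left gradient `∇₁F`, defined by `⟨X, ∇₁F(g, v)⟩ = d/dt F(e^{tX} g, v)` at `t = 0`; the right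
side is the derivative at `x = 1` of `x ↦ F(x g, v)` in the direction `X`. -/
noncomputable def gradL {V : Type*} (c : ℝ) (F : G × V → ℝ) (p : G × V) : LieAlg E G :=
  rep (form E G c) fun X => mfderiv 𝓘(ℝ, E) 𝓘(ℝ, ℝ) (fun x : G => F (x * p.1, p.2)) 1 X

/-- The right gradient `∇₁'F`, defined by `⟨X, ∇₁'F(g, v)⟩ = d/dt F(g e^{tX}, v)` at `t = 0`. -/
noncomputable def gradR {V : Type*} (c : ℝ) (F : G × V → ℝ) (p : G × V) : LieAlg E G :=
  rep (form E G c) fun X => mfderiv 𝓘(ℝ, E) 𝓘(ℝ, ℝ) (fun x : G => F (p.1 * x, p.2)) 1 X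

/-- The gradient `d₂Φ` of a function on `G × Lie(G)` with respect to the second variable:
`⟨X, d₂Φ(g, J)⟩ = d/dt Φ(g, J + t X)` at `t = 0`. -/
noncomputable def d2 (c : ℝ) (Φ : G × LieAlg E G → ℝ) (p : G × LieAlg E G) : LieAlg E G :=
  rep (form E G c) fun X => deriv (fun t : ℝ => Φ (p.1, p.2 + t • X)) 0

/-- The `Lie(G₀)`-valued gradient `d₂F` of a function on `G × Lie(G₀)`:
`⟨X₀, d₂F(g, Λ)⟩ = d/dt F(g, Λ + t X₀)` at `t = 0`, for all `X₀ ∈ Lie(G₀)`. -/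
noncomputable def d2Slice (c : ℝ) (G₀ : Subgroup G) (F : G × subgroupLie E G₀ → ℝ)
    (p : G × subgroupLie E G₀) : subgroupLie E G₀ :=
  rep ((form E G c).restrict (subgroupLie E G₀))
    fun X₀ => deriv (fun t : ℝ => F (p.1, p.2 + t • X₀)) 0

/-- The canonical Poisson bracket on `T*G ≅ G × Lie(G)` (right trivialization). -/
noncomputable def poissonBracket (c : ℝ) (Φ Ψ : G × LieAlg E G → ℝ) (p : G × LieAlg E G) : ℝ :=
  form E G c (gradL c Φ p) (d2 c Ψ p) - form E G c (gradL c Ψ p) (d2 c Φ p)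
    + form E G c p.2 ⁅d2 c Φ p, d2 c Ψ p⁆

variable (E) in
/-- The orthogonal complement of `Lie(G₀)`. -/
noncomputable def perp (c : ℝ) (G₀ : Subgroup G) : Submodule ℝ (LieAlg E G) :=
  (form E G c).orthogonal (subgroupLie E G₀)

/-- The component `X_⊥` of `X = X₀ + X_⊥`, with `X₀ ∈ Lie(G₀)` and `X_⊥` in its complement. -/
noncomputable def perpPart (c : ℝ) (G₀ : Subgroup G) (X : LieAlg E G) : LieAlg E G :=
  Classical.epsilon fun Y => Y ∈ perp E c G₀ ∧ X - Y ∈ subgroupLie E G₀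

/-- The rational dynamical r-matrix `r(Λ) X = (ad_Λ restricted to the complement)⁻¹ X_⊥`. -/
noncomputable def rMatrix (c : ℝ) (G₀ : Subgroup G) (Λ : LieAlg E G) (X : LieAlg E G) :
    LieAlg E G :=
  Function.invFunOn (fun Y : LieAlg E G => ⁅Λ, Y⁆) (perp E c G₀ : Set (LieAlg E G))
    (perpPart c G₀ X)

end Bracket

end CotangentReduction

open CotangentReduction

/-! Averaging over the compact group gives an `Ad`-invariant inner product, for which every `ad X`
is skew. Hence `tr (ad X)²` is minus a sum of squares, and it vanishes only for central `X`, that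
is, for `X = 0` (`form_neg`). For regular `Λ` in `Lie(G₀)` the kernel of `ad Λ` is exactly `Lie(G₀)`
(`mem_subgroupLie_iff_lie_eq_zero`). A skew map with this kernel is bijective on the orthogonal
complement (`IsNegInvariant.bijOn`).

For the bracket, differentiating the invariance of `Φ` along conjugation gives `[Λ, d₂Φ] = ∇₁'Φ -
∇₁Φ` (`lie_d2`). This determines the orthogonal part of `d₂Φ` as `r(Λ)(∇₁'Φ - ∇₁Φ)`, while its part
in `Lie(G₀)` is `d₂F` (`d2Slice_spec`). Substituting both into the canonical bracket and using the
antisymmetry of `r(Λ)`, the mixed terms cancel (`IsNegInvariant.reduced_bracket`).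

The link between group and algebra is that the derivative of `Ad` at the identity is the bracket of
left-invariant fields (`adCLM_apply`). -/

namespace CotangentReduction

open scoped Topology
open Filter

/-! ### Smoothness of the adjoint representation -/

section AdjointAction

variable {E G : Type*} [NormedAddCommGroup E] [NormedSpace ℝ E]
  [TopologicalSpace G] [ChartedSpace E G] [Group G] [LieGroup 𝓘(ℝ, E) ∞ G]

theorem isManifold_one : IsManifold 𝓘(ℝ, E) 1 G := by
  have : IsManifold 𝓘(ℝ, E) ∞ G := inferInstance
  exact IsManifold.of_le (n := ∞) (by simp)

theorem mdifferentiableAt_conj (η x : G) :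
    MDifferentiableAt 𝓘(ℝ, E) 𝓘(ℝ, E) (fun x : G => η * x * η⁻¹) x := by
  have : ContMDiff 𝓘(ℝ, E) 𝓘(ℝ, E) ∞ (fun x : G => η * x * η⁻¹) :=
    (contMDiff_const.mul contMDiff_id).mul contMDiff_const
  exact this.mdifferentiable (by simp) x

theorem mdifferentiableAt_mul_left' (η x : G) :
    MDifferentiableAt 𝓘(ℝ, E) 𝓘(ℝ, E) (fun x : G => η * x) x := by
  have : ContMDiff 𝓘(ℝ, E) 𝓘(ℝ, E) ∞ (fun x : G => η * x) := contMDiff_const.mul contMDiff_id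
  exact this.mdifferentiable (by simp) x

theorem mdifferentiableAt_mul_right' (η x : G) :
    MDifferentiableAt 𝓘(ℝ, E) 𝓘(ℝ, E) (fun x : G => x * η) x := by
  have : ContMDiff 𝓘(ℝ, E) 𝓘(ℝ, E) ∞ (fun x : G => x * η) := contMDiff_id.mul contMDiff_const
  exact this.mdifferentiable (by simp) x

variable (E) in
/-- The adjoint action as a continuous linear map of the model space. -/
noncomputable def AdCLM (η : G) : E →L[ℝ] E :=
  mfderiv 𝓘(ℝ, E) 𝓘(ℝ, E) (fun x : G => η * x * η⁻¹) 1

theorem hasMFDerivAt_conj (η : G) :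
    HasMFDerivAt 𝓘(ℝ, E) 𝓘(ℝ, E) (fun x : G => η * x * η⁻¹) 1 (AdCLM E η) :=
  (mdifferentiableAt_conj η 1).hasMFDerivAt

theorem AdCLM_one : AdCLM E (1 : G) = ContinuousLinearMap.id ℝ E := by
  have h := hasMFDerivAt_conj (E := E) (1 : G)
  have h2 : HasMFDerivAt 𝓘(ℝ, E) 𝓘(ℝ, E) (fun x : G => 1 * x * 1⁻¹) 1
      (ContinuousLinearMap.id ℝ E) := by
    have e : (fun x : G => 1 * x * 1⁻¹) = id := by funext x; simp
    rw [e]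
    exact hasMFDerivAt_id (1 : G)
  exact hasMFDerivAt_unique h h2

theorem AdCLM_mul (η ξ : G) : AdCLM E (η * ξ) = (AdCLM E η).comp (AdCLM E ξ) := by
  have h := hasMFDerivAt_conj (E := E) (η * ξ)
  have h1 : HasMFDerivAt 𝓘(ℝ, E) 𝓘(ℝ, E) (fun x : G => η * x * η⁻¹) (ξ * 1 * ξ⁻¹)
      (AdCLM E η) := by
    rw [show ξ * 1 * ξ⁻¹ = 1 by group]
    exact hasMFDerivAt_conj η
  have h2 := h1.comp (1 : G) (hasMFDerivAt_conj (E := E) ξ)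
  have e : (fun x : G => η * x * η⁻¹) ∘ (fun x : G => ξ * x * ξ⁻¹)
      = fun x : G => (η * ξ) * x * (η * ξ)⁻¹ := by
    funext x; simp [mul_assoc]
  rw [e] at h2
  exact hasMFDerivAt_unique h h2

theorem contMDiff_AdCLM : ContMDiff 𝓘(ℝ, E) 𝓘(ℝ, E →L[ℝ] E) ∞ (AdCLM E : G → E →L[ℝ] E) := by
  intro x₀
  have hf : ContMDiffAt (𝓘(ℝ, E).prod 𝓘(ℝ, E)) 𝓘(ℝ, E) ∞
      (Function.uncurry fun x y : G => x * y * x⁻¹) (x₀, 1) := by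
    have : ContMDiff (𝓘(ℝ, E).prod 𝓘(ℝ, E)) 𝓘(ℝ, E) ∞
        (fun p : G × G => p.1 * p.2 * p.1⁻¹) :=
      (contMDiff_fst.mul contMDiff_snd).mul contMDiff_fst.inv
    exact this.contMDiffAt
  have : IsManifold 𝓘(ℝ, E) 1 G := isManifold_one
  have h := hf.mfderiv (m := ∞) (fun x y : G => x * y * x⁻¹) (fun _ => (1 : G))
    contMDiffAt_const (by simp)
  refine h.congr_of_eventuallyEq (Eventually.of_forall fun x => ?_)
  rw [inTangentCoordinates_eq_mfderiv_comp (by simp) (by simp)]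
  -- Conjugation fixes `1`, so both coordinate changes are taken at the centre of the chart, where
  -- they are the identity.
  have e1 : mfderiv 𝓘(ℝ, E) 𝓘(ℝ, E) (extChartAt 𝓘(ℝ, E) (x₀ * 1 * x₀⁻¹)) (x * 1 * x⁻¹)
      = ContinuousLinearMap.id ℝ E := by
    rw [show x * 1 * x⁻¹ = 1 by group, show x₀ * 1 * x₀⁻¹ = 1 by group]
    exact mfderiv_extChartAt_self
  have e2 : mfderivWithin 𝓘(ℝ, E) 𝓘(ℝ, E) (extChartAt 𝓘(ℝ, E) (1 : G)).symm
      (Set.range 𝓘(ℝ, E)) (extChartAt 𝓘(ℝ, E) (1 : G) 1) = ContinuousLinearMap.id ℝ E :=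
    mfderivWithin_range_extChartAt_symm
  ext v
  exact (DFunLike.congr_fun e1 _).trans
    (congrArg (AdCLM E x) (DFunLike.congr_fun e2 v)) |>.symm

end AdjointAction

/-! ### The derivative of `Ad` at the identity is the Lie bracket -/

section DerivativeOfAd

variable {E G : Type*} [NormedAddCommGroup E] [NormedSpace ℝ E]
  [TopologicalSpace G] [ChartedSpace E G] [Group G]

variable (E G) in
/-- The multiplication of `G` read in the chart at the identity. -/
noncomputable def chartMul (q : E × E) : E :=
  extChartAt 𝓘(ℝ, E) (1 : G)
    ((extChartAt 𝓘(ℝ, E) (1 : G)).symm q.1 * (extChartAt 𝓘(ℝ, E) (1 : G)).symm q.2)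

variable (E) in
/-- The derivative at `1` of `y ↦ x y`, read in the chart at the identity. -/
noncomputable def leftMulDeriv (x : G) : E →L[ℝ] E :=
  mfderiv 𝓘(ℝ, E) 𝓘(ℝ, E) (fun y : G => extChartAt 𝓘(ℝ, E) (1 : G) (x * y)) 1

variable (E) in
/-- The derivative at `1` of `y ↦ y x`, read in the chart at the identity. -/
noncomputable def rightMulDeriv (x : G) : E →L[ℝ] E :=
  mfderiv 𝓘(ℝ, E) 𝓘(ℝ, E) (fun y : G => extChartAt 𝓘(ℝ, E) (1 : G) (y * x)) 1

variable [LieGroup 𝓘(ℝ, E) ∞ G]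

theorem hasMFDerivAt_leftMul {x : G} (hx : x ∈ (chartAt E (1 : G)).source) :
    HasMFDerivAt 𝓘(ℝ, E) 𝓘(ℝ, E) (fun y : G => extChartAt 𝓘(ℝ, E) (1 : G) (x * y)) 1
      (leftMulDeriv E x) := by
  have : IsManifold 𝓘(ℝ, E) 1 G := isManifold_one
  refine MDifferentiableAt.hasMFDerivAt ?_
  refine MDifferentiableAt.comp (I' := 𝓘(ℝ, E)) (1 : G) (g := extChartAt 𝓘(ℝ, E) (1 : G)) ?_
    (mdifferentiableAt_mul_left' x 1)
  exact mdifferentiableAt_extChartAt (by simpa using hx)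

theorem hasMFDerivAt_rightMul {x : G} (hx : x ∈ (chartAt E (1 : G)).source) :
    HasMFDerivAt 𝓘(ℝ, E) 𝓘(ℝ, E) (fun y : G => extChartAt 𝓘(ℝ, E) (1 : G) (y * x)) 1
      (rightMulDeriv E x) := by
  have : IsManifold 𝓘(ℝ, E) 1 G := isManifold_one
  refine MDifferentiableAt.hasMFDerivAt ?_
  refine MDifferentiableAt.comp (I' := 𝓘(ℝ, E)) (1 : G) (g := extChartAt 𝓘(ℝ, E) (1 : G)) ?_
    (mdifferentiableAt_mul_right' x 1)
  exact mdifferentiableAt_extChartAt (by simpa using hx)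

/-- Chain rule for `x y = (x y x⁻¹) x` at `y = 1`. This is how `Ad` enters the second derivatives of
the multiplication. -/
theorem leftMulDeriv_eq {x : G} (hx : x ∈ (chartAt E (1 : G)).source) :
    leftMulDeriv E x = (rightMulDeriv E x).comp (AdCLM E x) := by
  have h1 : HasMFDerivAt 𝓘(ℝ, E) 𝓘(ℝ, E)
      (fun y : G => extChartAt 𝓘(ℝ, E) (1 : G) (y * x)) (x * 1 * x⁻¹) (rightMulDeriv E x) := by
    rw [show x * 1 * x⁻¹ = 1 by group]
    exact hasMFDerivAt_rightMul hx
  have h2 := h1.comp (1 : G) (hasMFDerivAt_conj (E := E) x)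
  have e : (fun y : G => extChartAt 𝓘(ℝ, E) (1 : G) (y * x)) ∘ (fun y : G => x * y * x⁻¹)
      = fun y : G => extChartAt 𝓘(ℝ, E) (1 : G) (x * y) := by
    funext y; simp [mul_assoc]
  rw [e] at h2
  exact hasMFDerivAt_unique (hasMFDerivAt_leftMul hx) h2

theorem hasMFDerivAt_chart_symm :
    HasMFDerivAt 𝓘(ℝ, E) 𝓘(ℝ, E) (extChartAt 𝓘(ℝ, E) (1 : G)).symm
      (extChartAt 𝓘(ℝ, E) (1 : G) 1) (ContinuousLinearMap.id ℝ E) := by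
  have : IsManifold 𝓘(ℝ, E) 1 G := isManifold_one
  have h := mdifferentiableWithinAt_extChartAt_symm (I := 𝓘(ℝ, E)) (x := (1 : G))
    (mem_extChartAt_target (1 : G))
  have h2 := h.hasMFDerivWithinAt
  rw [mfderivWithin_range_extChartAt_symm, modelWithCornersSelf_coe, Set.range_id] at h2
  exact hasMFDerivWithinAt_univ.mp h2

theorem contDiffAt_chartMul {q : E × E}
    (h1 : q.1 ∈ (extChartAt 𝓘(ℝ, E) (1 : G)).target)
    (h2 : q.2 ∈ (extChartAt 𝓘(ℝ, E) (1 : G)).target)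
    (h3 : (extChartAt 𝓘(ℝ, E) (1 : G)).symm q.1 * (extChartAt 𝓘(ℝ, E) (1 : G)).symm q.2
      ∈ (chartAt E (1 : G)).source) :
    ContDiffAt ℝ ∞ (chartMul E G) q := by
  rw [← contMDiffAt_iff_contDiffAt]
  have : IsManifold 𝓘(ℝ, E) ∞ G := inferInstance
  have s : ∀ u ∈ (extChartAt 𝓘(ℝ, E) (1 : G)).target,
      ContMDiffAt 𝓘(ℝ, E) 𝓘(ℝ, E) ∞ (extChartAt 𝓘(ℝ, E) (1 : G)).symm u := fun u hu =>
    (contMDiffOn_extChartAt_symm (1 : G)).contMDiffAt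
      ((isOpen_extChartAt_target (1 : G)).mem_nhds hu)
  have m : ContMDiffAt 𝓘(ℝ, E × E) 𝓘(ℝ, E) ∞ (fun q : E × E =>
      (extChartAt 𝓘(ℝ, E) (1 : G)).symm q.1 * (extChartAt 𝓘(ℝ, E) (1 : G)).symm q.2) q :=
    ContMDiffAt.mul (I := 𝓘(ℝ, E))
      (ContMDiffAt.comp q (s _ h1) contDiff_fst.contMDiff.contMDiffAt)
      (ContMDiffAt.comp q (s _ h2) contDiff_snd.contMDiff.contMDiffAt)
  exact ContMDiffAt.comp q (contMDiffAt_extChartAt' h3) m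

theorem contDiffAt_chartMul_left {u : E} (hu : u ∈ (extChartAt 𝓘(ℝ, E) (1 : G)).target) :
    ContDiffAt ℝ ∞ (chartMul E G) (u, extChartAt 𝓘(ℝ, E) (1 : G) 1) := by
  refine contDiffAt_chartMul hu (mem_extChartAt_target (1 : G)) ?_
  have := (extChartAt 𝓘(ℝ, E) (1 : G)).map_target hu
  rw [extChartAt_source] at this
  rwa [extChartAt_to_inv, mul_one]

theorem contDiffAt_chartMul_right {u : E} (hu : u ∈ (extChartAt 𝓘(ℝ, E) (1 : G)).target) :
    ContDiffAt ℝ ∞ (chartMul E G) (extChartAt 𝓘(ℝ, E) (1 : G) 1, u) := by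
  refine contDiffAt_chartMul (mem_extChartAt_target (1 : G)) hu ?_
  have := (extChartAt 𝓘(ℝ, E) (1 : G)).map_target hu
  rw [extChartAt_source] at this
  rwa [extChartAt_to_inv, one_mul]

theorem fderiv_chartMul_left {u : E} (hu : u ∈ (extChartAt 𝓘(ℝ, E) (1 : G)).target) (Y : E) :
    fderiv ℝ (chartMul E G) (u, extChartAt 𝓘(ℝ, E) (1 : G) 1) (0, Y)
      = leftMulDeriv E ((extChartAt 𝓘(ℝ, E) (1 : G)).symm u) Y := by
  have hs := (extChartAt 𝓘(ℝ, E) (1 : G)).map_target hu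
  rw [extChartAt_source] at hs
  have h1 : HasMFDerivAt 𝓘(ℝ, E) 𝓘(ℝ, E)
      (fun y : G => extChartAt 𝓘(ℝ, E) (1 : G) ((extChartAt 𝓘(ℝ, E) (1 : G)).symm u * y))
      ((extChartAt 𝓘(ℝ, E) (1 : G)).symm (extChartAt 𝓘(ℝ, E) (1 : G) 1))
      (leftMulDeriv E ((extChartAt 𝓘(ℝ, E) (1 : G)).symm u)) := by
    rw [extChartAt_to_inv]
    exact hasMFDerivAt_leftMul hs
  have h2 := (h1.comp _ hasMFDerivAt_chart_symm).hasFDerivAt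
  have h3 : HasFDerivAt (fun y : E => chartMul E G (u, y)) _ (extChartAt 𝓘(ℝ, E) (1 : G) 1) :=
    ((contDiffAt_chartMul_left hu).differentiableAt (by simp)).hasFDerivAt.comp _
      (hasFDerivAt_prodMk_right u (extChartAt 𝓘(ℝ, E) (1 : G) 1))
  have := DFunLike.congr_fun (h3.unique h2) Y
  simpa using! this

theorem fderiv_chartMul_right {u : E} (hu : u ∈ (extChartAt 𝓘(ℝ, E) (1 : G)).target) (Y : E) :
    fderiv ℝ (chartMul E G) (extChartAt 𝓘(ℝ, E) (1 : G) 1, u) (Y, 0)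
      = rightMulDeriv E ((extChartAt 𝓘(ℝ, E) (1 : G)).symm u) Y := by
  have hs := (extChartAt 𝓘(ℝ, E) (1 : G)).map_target hu
  rw [extChartAt_source] at hs
  have h1 : HasMFDerivAt 𝓘(ℝ, E) 𝓘(ℝ, E)
      (fun y : G => extChartAt 𝓘(ℝ, E) (1 : G) (y * (extChartAt 𝓘(ℝ, E) (1 : G)).symm u))
      ((extChartAt 𝓘(ℝ, E) (1 : G)).symm (extChartAt 𝓘(ℝ, E) (1 : G) 1))
      (rightMulDeriv E ((extChartAt 𝓘(ℝ, E) (1 : G)).symm u)) := by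
    rw [extChartAt_to_inv]
    exact hasMFDerivAt_rightMul hs
  have h2 := (h1.comp _ hasMFDerivAt_chart_symm).hasFDerivAt
  have h3 : HasFDerivAt (fun y : E => chartMul E G (y, u)) _ (extChartAt 𝓘(ℝ, E) (1 : G) 1) :=
    ((contDiffAt_chartMul_right hu).differentiableAt (by simp)).hasFDerivAt.comp
      (extChartAt 𝓘(ℝ, E) (1 : G) 1)
      (f := fun y : E => (y, u)) (hasFDerivAt_prodMk_left (extChartAt 𝓘(ℝ, E) (1 : G) 1) u)
  have := DFunLike.congr_fun (h3.unique h2) Y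
  simpa using! this

theorem rightMulDeriv_one (Y : E) : rightMulDeriv E (1 : G) Y = Y := by
  have : IsManifold 𝓘(ℝ, E) 1 G := isManifold_one
  have h : rightMulDeriv E (1 : G) = ContinuousLinearMap.id ℝ E := by
    have e : (fun y : G => extChartAt 𝓘(ℝ, E) (1 : G) (y * 1)) = extChartAt 𝓘(ℝ, E) (1 : G) := by
      funext y; rw [mul_one]
    have h1 := hasMFDerivAt_rightMul (E := E) (mem_chart_source E (1 : G))
    rw [e] at h1
    have h2 : HasMFDerivAt 𝓘(ℝ, E) 𝓘(ℝ, E) (extChartAt 𝓘(ℝ, E) (1 : G)) 1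
        (mfderiv 𝓘(ℝ, E) 𝓘(ℝ, E) (extChartAt 𝓘(ℝ, E) (1 : G)) 1) :=
      (mdifferentiableAt_extChartAt (mem_chart_source E (1 : G))).hasMFDerivAt
    exact (hasMFDerivAt_unique h1 h2).trans mfderiv_extChartAt_self
  rw [h]; rfl

/-- Pulling back by the inverse chart is pushing forward by the chart, and the left-invariant field
at `x` is the derivative of `y ↦ x y` applied to `Y`. The bracket of the Lie algebra is computed
from these fields. -/
theorem mpullbackWithin_mulInvariantVectorField {u : E}
    (hu : u ∈ (extChartAt 𝓘(ℝ, E) (1 : G)).target) (Y : LieAlg E G) :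
    VectorField.mpullbackWithin 𝓘(ℝ, E) 𝓘(ℝ, E) (extChartAt 𝓘(ℝ, E) (1 : G)).symm
      (mulInvariantVectorField Y) (Set.range 𝓘(ℝ, E)) u
      = leftMulDeriv E ((extChartAt 𝓘(ℝ, E) (1 : G)).symm u) Y := by
  have : IsManifold 𝓘(ℝ, E) 1 G := isManifold_one
  have hs := (extChartAt 𝓘(ℝ, E) (1 : G)).map_target hu
  rw [VectorField.mpullbackWithin_apply,
    ContinuousLinearMap.inverse_eq (mfderivWithin_extChartAt_symm_comp_mfderiv_extChartAt hu)
      (mfderiv_extChartAt_comp_mfderivWithin_extChartAt_symm hu)]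
  set x := (extChartAt 𝓘(ℝ, E) (1 : G)).symm u
  rw [extChartAt_source] at hs
  have h1 : HasMFDerivAt 𝓘(ℝ, E) 𝓘(ℝ, E) (extChartAt 𝓘(ℝ, E) (1 : G)) (x * 1)
      (mfderiv 𝓘(ℝ, E) 𝓘(ℝ, E) (extChartAt 𝓘(ℝ, E) (1 : G)) x) := by
    rw [mul_one]
    exact (mdifferentiableAt_extChartAt hs).hasMFDerivAt
  have h2 := h1.comp (1 : G) (mdifferentiableAt_mul_left' (E := E) x 1).hasMFDerivAt
  exact (DFunLike.congr_fun (hasMFDerivAt_unique (hasMFDerivAt_leftMul hs) h2) Y).symm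

variable (E G) in
/-- The derivative of the adjoint action at the identity. -/
noncomputable def adCLM : E →L[ℝ] E →L[ℝ] E :=
  mfderiv 𝓘(ℝ, E) 𝓘(ℝ, E →L[ℝ] E) (AdCLM E : G → E →L[ℝ] E) 1

theorem hasMFDerivAt_AdCLM_one :
    HasMFDerivAt 𝓘(ℝ, E) 𝓘(ℝ, E →L[ℝ] E) (AdCLM E : G → E →L[ℝ] E) 1 (adCLM E G) :=
  (contMDiff_AdCLM.mdifferentiable (by simp) 1).hasMFDerivAt

/-- With `p'` the second derivative of the multiplication in the chart, the bracket of
left-invariant fields is `p' (X, 0) (0, Y) - p' (Y, 0) (0, X)`. Differentiating `leftMulDeriv_eq` at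
the identity expresses the first term through `ad X Y`, and symmetry of `p'` cancels the rest. -/
theorem adCLM_apply (X Y : LieAlg E G) : adCLM E G X Y = ⁅X, Y⁆ := by
  have : IsManifold 𝓘(ℝ, E) 1 G := isManifold_one
  set φ := extChartAt 𝓘(ℝ, E) (1 : G) with hφ
  set e : E := φ 1 with he
  set p := fderiv ℝ (chartMul E G) with hp
  have hT : φ.target ∈ 𝓝 e := extChartAt_target_mem_nhds (1 : G)
  have heT : e ∈ φ.target := mem_extChartAt_target (1 : G)
  have hc : ContDiffAt ℝ ∞ (chartMul E G) (e, e) := contDiffAt_chartMul_left heT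
  have hpd : HasFDerivAt p (fderiv ℝ p (e, e)) (e, e) :=
    ((hc.fderiv_right (m := ∞) (by simp)).differentiableAt (by simp)).hasFDerivAt
  set p' := fderiv ℝ p (e, e) with hp'
  have hsymm : ∀ v w, p' v w = p' w v := by
    intro v w
    refine second_derivative_symmetric_of_eventually_of_real (f := chartMul E G) (x := (e, e))
      ?_ hpd v w
    have := (hc.of_le (m := 1) (by simp)).eventually (by simp)
    filter_upwards [this] with q hq
    exact (hq.differentiableAt (by simp)).hasFDerivAt
  have hleft : ∀ Z : E, HasFDerivAt
      (fun u => leftMulDeriv E (φ.symm u) Z)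
      ((p'.flip (0, Z)).comp (ContinuousLinearMap.inl ℝ E E)) e := by
    intro Z
    have h1 : HasFDerivAt (fun u : E => p (u, e)) (p'.comp (ContinuousLinearMap.inl ℝ E E)) e :=
      hpd.comp e (f := fun u : E => (u, e)) (hasFDerivAt_prodMk_left e e)
    have h2 := h1.clm_apply (hasFDerivAt_const ((0, Z) : E × E) e)
    refine (h2.congr_of_eventuallyEq ?_).congr_fderiv ?_
    · filter_upwards [hT] with u hu
      exact (fderiv_chartMul_left hu Z).symm
    · ext w; simp
  have hA : HasFDerivAt (fun u => AdCLM E (φ.symm u)) (adCLM E G) e := by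
    have h1 : HasMFDerivAt 𝓘(ℝ, E) 𝓘(ℝ, E →L[ℝ] E) (AdCLM E : G → E →L[ℝ] E) (φ.symm e)
        (adCLM E G) := by
      rw [he, hφ, extChartAt_to_inv]
      exact hasMFDerivAt_AdCLM_one
    exact (h1.comp _ hasMFDerivAt_chart_symm).hasFDerivAt
  set A' := adCLM E G
  have hA1 : AdCLM E (φ.symm e) = ContinuousLinearMap.id ℝ E := by
    rw [he, hφ, extChartAt_to_inv, AdCLM_one]
  have key : ∀ Z W : E, p' (W, 0) (0, Z) = p' (0, W) (Z, 0) + A' W Z := by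
    intro Z W
    have h1 : HasFDerivAt (fun u : E => p (e, u)) (p'.comp (ContinuousLinearMap.inr ℝ E E)) e :=
      hpd.comp e (f := fun u : E => (e, u)) (hasFDerivAt_prodMk_right e e)
    -- Product rule for `p (e, u) (Ad Z, 0)`, where both the right translation and `Ad` depend on
    -- `u`.
    have h2 := h1.clm_apply (((hA.clm_apply (hasFDerivAt_const Z e))).prodMk
      (hasFDerivAt_const (0 : E) e))
    have h3 := h2.congr_of_eventuallyEq (f₁ := fun u => leftMulDeriv E (φ.symm u) Z) (by
      filter_upwards [hT] with u hu
      have hs := φ.map_target hu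
      rw [hφ, extChartAt_source] at hs
      rw [leftMulDeriv_eq hs]
      exact (fderiv_chartMul_right hu _).symm)
    have := DFunLike.congr_fun ((hleft Z).unique h3) W
    have h4 : ∀ V : E, p (e, e) (V, 0) = V := by
      intro V
      refine (fderiv_chartMul_right heT V).trans ?_
      rw [he, hφ, extChartAt_to_inv, rightMulDeriv_one]
    simpa [hA1, h4, add_comm] using this
  have hbr : ⁅X, Y⁆ = p' (X, 0) (0, Y) - p' (Y, 0) (0, X) := by
    have hinv : ∀ (L : E →L[ℝ] E), L = ContinuousLinearMap.id ℝ E → ∀ v, L.inverse v = v := by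
      rintro L rfl v
      rw [ContinuousLinearMap.inverse_id]
      rfl
    let V : LieAlg E G → E → E := fun Z =>
      VectorField.mpullbackWithin 𝓘(ℝ, E) 𝓘(ℝ, E) φ.symm (mulInvariantVectorField Z)
        (Set.range 𝓘(ℝ, E))
    have hV : ∀ Z : LieAlg E G, HasFDerivAt (V Z)
        ((p'.flip (0, Z)).comp (ContinuousLinearMap.inl ℝ E E)) e := by
      intro Z
      refine (hleft Z).congr_of_eventuallyEq ?_
      filter_upwards [hT] with u hu
      exact mpullbackWithin_mulInvariantVectorField hu Z
    have hVe : ∀ Z : LieAlg E G, V Z e = Z := by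
      intro Z
      refine (mpullbackWithin_mulInvariantVectorField heT Z).trans ?_
      rw [he, hφ, extChartAt_to_inv,
        leftMulDeriv_eq (mem_chart_source E (1 : G)), AdCLM_one]
      exact rightMulDeriv_one (E := E) Z
    -- The manifold bracket is the bracket in the chart transported by the inverse of the derivative
    -- of the chart, which is the identity at `1`.
    have h0 : ⁅X, Y⁆ = VectorField.lieBracketWithin ℝ (V X) (V Y)
        (φ.symm ⁻¹' Set.univ ∩ Set.range 𝓘(ℝ, E)) e :=
      hinv _ (mfderiv_extChartAt_self (I := 𝓘(ℝ, E)) (x := (1 : G))) _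
    refine h0.trans ?_
    rw [Set.preimage_univ, modelWithCornersSelf_coe, Set.range_id, Set.univ_inter,
      VectorField.lieBracketWithin_univ]
    change fderiv ℝ (V Y) e (V X e) - fderiv ℝ (V X) e (V Y e) = _
    rw [(hV X).fderiv, (hV Y).fderiv, hVe, hVe]
    rfl
  rw [hbr, key Y X]
  have := hsymm (0, X) (Y, 0)
  rw [this]
  abel

end DerivativeOfAd

/-! ### Negative definiteness of the Killing form -/

theorem trace_comp_self_neg_of_skew {V : Type*} [AddCommGroup V] [Module ℝ V]
    [FiniteDimensional ℝ V] (B : V →ₗ[ℝ] V →ₗ[ℝ] ℝ) (hsymm : ∀ x y, B x y = B y x)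
    (hpos : ∀ x, x ≠ 0 → 0 < B x x) (T : V →ₗ[ℝ] V) (hT : ∀ x y, B (T x) y = -B x (T y))
    (hT0 : T ≠ 0) : LinearMap.trace ℝ V (T ∘ₗ T) < 0 := by
  let core : InnerProductSpace.Core ℝ V :=
    { inner := fun x y => B x y
      conj_inner_symm := fun x y => by simpa using hsymm y x
      re_inner_nonneg := fun x => by
        rcases eq_or_ne x 0 with rfl | hx
        · simp
        · simpa using (hpos x hx).le
      add_left := fun x y z => by simp
      smul_left := fun x y r => by simp
      definite := fun x hx => by
        by_contra h
        exact (hpos x h).ne' hx }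
  let : NormedAddCommGroup V := core.toNormedAddCommGroup
  let : InnerProductSpace ℝ V := InnerProductSpace.ofCore core.toCore
  let b := stdOrthonormalBasis ℝ V
  have hin : ∀ x y : V, inner ℝ x y = B x y := fun _ _ => rfl
  have hterm : ∀ i, inner ℝ (b i) ((T ∘ₗ T) (b i)) = -B (T (b i)) (T (b i)) := by
    intro i
    rw [hin, LinearMap.comp_apply, hT, neg_neg]
  -- In a basis orthonormal for `B`, the trace of `T²` is `-∑ B (T bᵢ) (T bᵢ)`.
  rw [LinearMap.trace_eq_sum_inner _ b, Finset.sum_congr rfl fun i _ => hterm i,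
    Finset.sum_neg_distrib, neg_lt_zero]
  have hnn : ∀ x, 0 ≤ B x x := fun x => core.re_inner_nonneg x
  have hex : ∃ i, T (b i) ≠ 0 := by
    by_contra! h
    exact hT0 (b.toBasis.ext fun i => by simpa using h i)
  obtain ⟨i, hi⟩ := hex
  exact Finset.sum_pos' (fun j _ => hnn _) ⟨i, Finset.mem_univ i, hpos _ hi⟩

section Killing

variable {E G : Type*} [NormedAddCommGroup E] [NormedSpace ℝ E] [FiniteDimensional ℝ E]
  [TopologicalSpace G] [ChartedSpace E G] [Group G] [LieGroup 𝓘(ℝ, E) ∞ G]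

open MeasureTheory in
/-- A compact group carries an `Ad`-invariant inner product on its Lie algebra. -/
theorem exists_invariant_inner [T2Space G] [CompactSpace G] :
    ∃ B : E →ₗ[ℝ] E →ₗ[ℝ] ℝ, (∀ x y, B x y = B y x) ∧ (∀ x, x ≠ 0 → 0 < B x x) ∧
      ∀ (η : G) x y, B (AdCLM E η x) (AdCLM E η y) = B x y := by
  have : IsTopologicalGroup G := topologicalGroup_of_lieGroup 𝓘(ℝ, E) ∞
  let : MeasurableSpace G := borel G
  have : BorelSpace G := ⟨rfl⟩
  let μ : Measure G := Measure.haar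
  let f := toEuclidean (E := E)
  -- The inverse turns `Ad η` into the left translation `ξ ↦ η⁻¹ ξ`, so left invariance of Haar
  -- measure suffices.
  let w : E → E → G → ℝ := fun x y η => inner ℝ (f (AdCLM E η⁻¹ x)) (f (AdCLM E η⁻¹ y))
  have hAd : Continuous (fun η : G => AdCLM E η⁻¹) :=
    contMDiff_AdCLM.continuous.comp continuous_inv
  have hw : ∀ x y, Continuous (w x y) := fun x y =>
    (f.continuous.comp (hAd.clm_apply continuous_const)).inner
      (f.continuous.comp (hAd.clm_apply continuous_const))
  have hi : ∀ x y, Integrable (w x y) μ := fun x y =>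
    (hw x y).integrable_of_hasCompactSupport (HasCompactSupport.of_compactSpace _)
  let B : E →ₗ[ℝ] E →ₗ[ℝ] ℝ := LinearMap.mk₂ ℝ (fun x y => ∫ η, w x y η ∂μ)
    (fun x x' y => by
      rw [← integral_add (hi _ _) (hi _ _)]
      simp [w, inner_add_left])
    (fun r x y => by
      rw [smul_eq_mul, ← integral_const_mul]
      simp [w, inner_smul_left])
    (fun x y y' => by
      rw [← integral_add (hi _ _) (hi _ _)]
      simp [w, inner_add_right])
    (fun r x y => by
      rw [smul_eq_mul, ← integral_const_mul]
      simp [w, inner_smul_right])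
  refine ⟨B, fun x y => ?_, fun x hx => ?_, fun η x y => ?_⟩
  · exact integral_congr_ae (Eventually.of_forall fun η => real_inner_comm _ _)
  · refine (hw x x).integral_pos_of_hasCompactSupport_nonneg_nonzero
      (HasCompactSupport.of_compactSpace _) (fun η => real_inner_self_nonneg) (x := 1) ?_
    simp [w, AdCLM_one, hx]
  · have h : ∀ ξ, w (AdCLM E η x) (AdCLM E η y) ξ = w x y (η⁻¹ * ξ) := by
      intro ξ
      simp [w, AdCLM_mul]
    refine (integral_congr_ae (Eventually.of_forall h)).trans ?_
    exact integral_mul_left_eq_self (w x y) η⁻¹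

/-- Differentiate the constant function `η ↦ B (Ad_η x) (Ad_η y)` at `1`. -/
theorem skew_of_invariant (B : E →ₗ[ℝ] E →ₗ[ℝ] ℝ)
    (hB : ∀ (η : G) x y, B (AdCLM E η x) (AdCLM E η y) = B x y) (Z x y : E) :
    B (adCLM E G Z x) y = -B x (adCLM E G Z y) := by
  let q : (E →L[ℝ] E) → ℝ := fun A => B.toContinuousBilinearMap (A x) (A y)
  have hx : HasFDerivAt (fun A : E →L[ℝ] E => A x) (ContinuousLinearMap.apply ℝ E x)
      (ContinuousLinearMap.id ℝ E) := (ContinuousLinearMap.apply ℝ E x).hasFDerivAt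
  have hy : HasFDerivAt (fun A : E →L[ℝ] E => A y) (ContinuousLinearMap.apply ℝ E y)
      (ContinuousLinearMap.id ℝ E) := (ContinuousLinearMap.apply ℝ E y).hasFDerivAt
  have hBx : HasFDerivAt (fun A : E →L[ℝ] E => B.toContinuousBilinearMap (A x))
      (B.toContinuousBilinearMap.comp (ContinuousLinearMap.apply ℝ E x))
      (ContinuousLinearMap.id ℝ E) := B.toContinuousBilinearMap.hasFDerivAt.comp _ hx
  have hq := hBx.clm_apply hy
  rw [← AdCLM_one (G := G)] at hq
  have h := HasMFDerivAt.comp (1 : G) hq.hasMFDerivAt hasMFDerivAt_AdCLM_one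
  have hc : q ∘ (AdCLM E : G → E →L[ℝ] E) = fun _ => B x y := by
    funext η
    exact hB η x y
  rw [hc] at h
  have h0 := DFunLike.congr_fun (hasMFDerivAt_unique h (hasMFDerivAt_const (B x y) (1 : G))) Z
  have h1 : B (AdCLM E (1 : G) x) (adCLM E G Z y) + B (adCLM E G Z x) (AdCLM E (1 : G) y) = 0 := h0
  rw [AdCLM_one] at h1
  exact eq_neg_of_add_eq_zero_right h1

variable [CompleteSpace E]

theorem form_neg [T2Space G] [CompactSpace G] [LieAlgebra.IsSimple ℝ (LieAlg E G)]
    {c : ℝ} (hc : 0 < c) (X : LieAlg E G) (hX : X ≠ 0) : form E G c X X < 0 := by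
  obtain ⟨B, hs, hp, hinv⟩ := exists_invariant_inner (E := E) (G := G)
  have hk : killingForm ℝ (LieAlg E G) X X < 0 := by
    rw [killingForm_apply_apply]
    refine @trace_comp_self_neg_of_skew (LieAlg E G) _ _ (inferInstanceAs (FiniteDimensional ℝ E))
      B hs hp _ (fun x y => ?_) fun h0 => hX ?_
    · simpa only [adCLM_apply] using! skew_of_invariant B hinv X x y
    · have hm : X ∈ LieAlgebra.center ℝ (LieAlg E G) := by
        rw [LieModule.mem_maxTrivSubmodule]
        intro Y
        rw [← lie_skew, neg_eq_zero]
        exact LinearMap.congr_fun h0 Y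
      rw [LieAlgebra.center_eq_bot] at hm
      exact hm
  exact mul_neg_of_pos_of_neg hc hk

omit [FiniteDimensional ℝ E] in
theorem form_comm (c : ℝ) (X Y : LieAlg E G) : form E G c X Y = form E G c Y X :=
  congrArg (c * ·) (LieModule.traceForm_comm ℝ (LieAlg E G) (LieAlg E G) X Y)

omit [FiniteDimensional ℝ E] in
theorem form_lie (c : ℝ) (X Y Z : LieAlg E G) : form E G c ⁅X, Y⁆ Z = form E G c X ⁅Y, Z⁆ :=
  congrArg (c * ·) (LieModule.traceForm_apply_lie_apply ℝ (LieAlg E G) (LieAlg E G) X Y Z)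

end Killing

/-! ### One-parameter subgroups, tori and regular elements -/

section OneParam

variable {E G : Type*} [NormedAddCommGroup E] [NormedSpace ℝ E]
  [TopologicalSpace G] [ChartedSpace E G] [Group G]

namespace IsOneParam

theorem map_zero {γ : ℝ → G} {X : LieAlg E G} (h : IsOneParam γ X) : γ 0 = 1 := by
  simpa using h.map_add 0 0

theorem hasMFDerivAt {γ : ℝ → G} {X : LieAlg E G} (h : IsOneParam γ X) :
    HasMFDerivAt 𝓘(ℝ, ℝ) 𝓘(ℝ, E) γ 0 (ContinuousLinearMap.toSpanSingleton ℝ (X : E)) := by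
  have h1 := (h.smooth.mdifferentiable (by simp) 0).hasMFDerivAt
  have h2 : (mfderiv 𝓘(ℝ, ℝ) 𝓘(ℝ, E) γ 0 : ℝ →L[ℝ] E)
      = ContinuousLinearMap.toSpanSingleton ℝ (X : E) := by
    ext
    refine Eq.trans h.velocity ?_
    exact (one_smul ℝ (X : E)).symm
  exact h2 ▸ h1

theorem of_hasMFDerivAt {γ : ℝ → G} {X : LieAlg E G}
    (smooth : ContMDiff 𝓘(ℝ, ℝ) 𝓘(ℝ, E) ∞ γ) (map_add : ∀ s t, γ (s + t) = γ s * γ t)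
    {L : ℝ →L[ℝ] E} (hL : HasMFDerivAt 𝓘(ℝ, ℝ) 𝓘(ℝ, E) γ 0 L) (hX : L 1 = X) :
    IsOneParam γ X :=
  ⟨smooth, map_add, by
    have := hasMFDerivAt_unique (smooth.mdifferentiable (by simp) 0).hasMFDerivAt hL
    exact (DFunLike.congr_fun this (1 : ℝ)).trans hX⟩

theorem const_one : IsOneParam (fun _ : ℝ => (1 : G)) (0 : LieAlg E G) :=
  of_hasMFDerivAt contMDiff_const (by simp) (hasMFDerivAt_const (1 : G) (0 : ℝ)) rfl

theorem smul {γ : ℝ → G} {X : LieAlg E G} (h : IsOneParam γ X) (a : ℝ) :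
    IsOneParam (fun t => γ (a * t)) (a • X) := by
  have hd : HasFDerivAt (fun t : ℝ => a * t) (a • ContinuousLinearMap.id ℝ ℝ) (0 : ℝ) :=
    (hasFDerivAt_id (0 : ℝ)).const_mul a
  have h1 : HasMFDerivAt 𝓘(ℝ, ℝ) 𝓘(ℝ, E) γ (a * 0)
      (ContinuousLinearMap.toSpanSingleton ℝ (X : E)) := by
    rw [mul_zero]; exact h.hasMFDerivAt
  refine of_hasMFDerivAt (h.smooth.comp (contDiff_const.mul contDiff_id).contMDiff)
    (fun s t => by rw [mul_add, h.map_add])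
    (HasMFDerivAt.comp (0 : ℝ) h1 hd.hasMFDerivAt) ?_
  change (a * 1) • (X : E) = a • (X : E)
  rw [mul_one]

variable [LieGroup 𝓘(ℝ, E) ∞ G]

theorem mul {γ δ : ℝ → G} {X Y : LieAlg E G} (hγ : IsOneParam γ X) (hδ : IsOneParam δ Y)
    (hc : ∀ s t, γ s * δ t = δ t * γ s) : IsOneParam (fun t => γ t * δ t) (X + Y) := by
  have hm : MDifferentiableAt (𝓘(ℝ, E).prod 𝓘(ℝ, E)) 𝓘(ℝ, E) (fun p : G × G => p.1 * p.2)
      (γ 0, δ 0) := (contMDiff_mul 𝓘(ℝ, E) ∞).mdifferentiable (by simp) _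
  refine of_hasMFDerivAt (hγ.smooth.mul hδ.smooth) (fun s t => ?_)
    (HasMFDerivAt.comp (0 : ℝ) hm.hasMFDerivAt (hγ.hasMFDerivAt.prodMk hδ.hasMFDerivAt)) ?_
  · simp only [hγ.map_add, hδ.map_add]
    rw [mul_assoc, mul_assoc, ← mul_assoc (γ t), hc t s, mul_assoc]
  · refine (mfderiv_prod_eq_add_apply (v := ((((1 : ℝ) • (X : E)), ((1 : ℝ) • (Y : E))) : E × E))
      hm).trans ?_
    have e1 : (fun z : G => z * δ 0) = id := by funext z; simp [hδ.map_zero]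
    have e2 : (fun z : G => γ 0 * z) = id := by funext z; simp [hγ.map_zero]
    dsimp only
    rw [e1, e2, mfderiv_id, mfderiv_id]
    change (1 : ℝ) • (X : E) + (1 : ℝ) • (Y : E) = _
    rw [one_smul, one_smul]

/-- Since `γ r = γ t * γ (r - t)`, the velocity at `t` is the left translate by `γ t` of the
velocity at `0`. -/
theorem isMIntegralCurve {γ : ℝ → G} {X : LieAlg E G} (h : IsOneParam γ X) :
    IsMIntegralCurve γ (mulInvariantVectorField X : (g : G) → TangentSpace 𝓘(ℝ, E) g) := by
  intro t
  have h1 : HasMFDerivAt 𝓘(ℝ, E) 𝓘(ℝ, E) (fun x : G => γ t * x) (γ 0)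
      (mfderiv 𝓘(ℝ, E) 𝓘(ℝ, E) (fun x : G => γ t * x) 1) := by
    rw [h.map_zero]
    exact (mdifferentiableAt_mul_left' (γ t) 1).hasMFDerivAt
  have h2 := h1.comp (0 : ℝ) h.hasMFDerivAt
  have h3 : HasFDerivAt (fun r : ℝ => r - t) (ContinuousLinearMap.id ℝ ℝ) t :=
    (hasFDerivAt_id t).sub_const t
  have h4 : HasMFDerivAt 𝓘(ℝ, ℝ) 𝓘(ℝ, E) ((fun x : G => γ t * x) ∘ γ) (t - t)
      ((mfderiv 𝓘(ℝ, E) 𝓘(ℝ, E) (fun x : G => γ t * x) 1 : E →L[ℝ] E).comp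
        (ContinuousLinearMap.toSpanSingleton ℝ (X : E))) := by
    rw [sub_self]; exact h2
  have h5 := HasMFDerivAt.comp t (f := fun r : ℝ => r - t) h4 h3.hasMFDerivAt
  have e : ((fun x : G => γ t * x) ∘ γ) ∘ (fun r : ℝ => r - t) = γ := by
    funext r
    simp [← h.map_add]
  rw [e] at h5
  have hL : ∀ L L' : ℝ →L[ℝ] E, L 1 = L' 1 → L = L' := fun L L' h => by ext; exact h
  refine h5.congr_mfderiv (hL _ _ ?_)
  change (mfderiv 𝓘(ℝ, E) 𝓘(ℝ, E) (fun x : G => γ t * x) 1 : E →L[ℝ] E) ((1 : ℝ) • (X : E))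
    = (1 : ℝ) • (mfderiv 𝓘(ℝ, E) 𝓘(ℝ, E) (fun x : G => γ t * x) 1 : E →L[ℝ] E) X
  rw [one_smul, one_smul]

theorem unique [CompleteSpace E] [T2Space G] {γ δ : ℝ → G} {X : LieAlg E G}
    (hγ : IsOneParam γ X) (hδ : IsOneParam δ X) : γ = δ := by
  have : IsManifold 𝓘(ℝ, E) 1 G := isManifold_one
  refine isMIntegralCurve_Ioo_eq_of_contMDiff_boundaryless (I := 𝓘(ℝ, E)) (t₀ := 0)
    ((contMDiff_mulInvariantVectorField X).of_le ?_) hγ.isMIntegralCurve hδ.isMIntegralCurve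
    (hγ.map_zero.trans hδ.map_zero.symm)
  rw [minSmoothness_of_isRCLikeNormedField]
  norm_num

end IsOneParam

theorem isTorus_commute {T : Subgroup G} (hT : IsTorus E T) {x y : G} (hx : x ∈ T) (hy : y ∈ T) :
    x * y = y * x := by
  obtain ⟨k, ψ, -, hψ, -, hr⟩ := hT
  rw [← SetLike.mem_coe, ← hr] at hx hy
  obtain ⟨a, rfl⟩ := hx
  obtain ⟨b, rfl⟩ := hy
  rw [← hψ, add_comm, hψ]

/-- A torus is the image of a vector space; take the image of the line through a preimage of `g`. -/
theorem exists_oneParam_of_mem_torus {T : Subgroup G} (hT : IsTorus E T) {g : G} (hg : g ∈ T) :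
    ∃ (X : LieAlg E G) (γ : ℝ → G), IsOneParam γ X ∧ (∀ t, γ t ∈ T) ∧ γ 1 = g := by
  obtain ⟨k, ψ, hs, hψ, -, hr⟩ := hT
  rw [← SetLike.mem_coe, ← hr] at hg
  obtain ⟨a, rfl⟩ := hg
  refine ⟨mfderiv 𝓘(ℝ, ℝ) 𝓘(ℝ, E) (fun t : ℝ => ψ (t • a)) 0 (1 : ℝ), fun t => ψ (t • a),
    ⟨?_, fun s t => by rw [add_smul, hψ], rfl⟩, fun t => ?_, by simp⟩
  · exact hs.comp (contDiff_id.smul contDiff_const).contMDiff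
  · rw [← SetLike.mem_coe, ← hr]
    exact ⟨_, rfl⟩

/-- In a commutative subgroup, products of one-parameter subgroups are again such, so the generators
already form a subspace and the span adds nothing. -/
theorem mem_subgroupLie_iff [LieGroup 𝓘(ℝ, E) ∞ G] {T : Subgroup G}
    (hT : ∀ x ∈ T, ∀ y ∈ T, x * y = y * x) {X : LieAlg E G} :
    X ∈ subgroupLie E T ↔ ∃ γ : ℝ → G, IsOneParam γ X ∧ ∀ t, γ t ∈ T := by
  refine ⟨fun h => ?_, fun h => Submodule.subset_span h⟩
  induction h using Submodule.span_induction with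
  | mem X h => exact h
  | zero => exact ⟨_, IsOneParam.const_one, fun _ => T.one_mem⟩
  | add X Y _ _ hX hY =>
    obtain ⟨γ, hγ, hγT⟩ := hX
    obtain ⟨δ, hδ, hδT⟩ := hY
    exact ⟨_, hγ.mul hδ fun s t => hT _ (hγT s) _ (hδT t), fun t => T.mul_mem (hγT t) (hδT t)⟩
  | smul a X _ hX =>
    obtain ⟨γ, hγ, hγT⟩ := hX
    exact ⟨_, hγ.smul a, fun t => hγT _⟩

/-- Conjugation by `γ t` fixes `δ`, hence `Ad (γ t)` fixes `Y`; differentiate in `t`. -/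
theorem lie_eq_zero_of_oneParam_commute [LieGroup 𝓘(ℝ, E) ∞ G] {γ δ : ℝ → G} {X Y : LieAlg E G}
    (hγ : IsOneParam γ X) (hδ : IsOneParam δ Y) (hc : ∀ s t, γ s * δ t = δ t * γ s) :
    ⁅X, Y⁆ = 0 := by
  have h1 : ∀ t, AdCLM E (γ t) (Y : E) = Y := by
    intro t
    have h : HasMFDerivAt 𝓘(ℝ, E) 𝓘(ℝ, E) (fun x : G => γ t * x * (γ t)⁻¹) (δ 0)
        (AdCLM E (γ t)) := by
      rw [hδ.map_zero]
      exact hasMFDerivAt_conj (γ t)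
    have h2 := h.comp (0 : ℝ) hδ.hasMFDerivAt
    have e : (fun x : G => γ t * x * (γ t)⁻¹) ∘ δ = δ := by
      funext s
      simp [hc]
    rw [e] at h2
    have h3 : AdCLM E (γ t) ((1 : ℝ) • (Y : E)) = (1 : ℝ) • (Y : E) :=
      DFunLike.congr_fun (hasMFDerivAt_unique h2 hδ.hasMFDerivAt) (1 : ℝ)
    rwa [one_smul] at h3
  have h2 : HasMFDerivAt 𝓘(ℝ, E) 𝓘(ℝ, E →L[ℝ] E) (AdCLM E : G → E →L[ℝ] E) (γ 0)
      (adCLM E G) := by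
    rw [hγ.map_zero]
    exact hasMFDerivAt_AdCLM_one
  have h3 := h2.comp (0 : ℝ) hγ.hasMFDerivAt
  have key : ∀ y : E, (∀ t, AdCLM E (γ t) y = y) → adCLM E G ((1 : ℝ) • (X : E)) y = 0 := by
    intro y hy
    have h4 := HasMFDerivAt.comp (0 : ℝ)
      (ContinuousLinearMap.apply ℝ E y).hasFDerivAt.hasMFDerivAt h3
    have e : (ContinuousLinearMap.apply ℝ E y) ∘ (AdCLM E : G → E →L[ℝ] E) ∘ γ
        = fun _ => y := funext hy
    rw [e] at h4
    exact DFunLike.congr_fun (hasMFDerivAt_unique h4 (hasMFDerivAt_const y (0 : ℝ))) (1 : ℝ)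
  have h5 := key Y h1
  rw [one_smul] at h5
  exact (adCLM_apply X Y).symm.trans h5

theorem lie_eq_zero_of_mem_torus [LieGroup 𝓘(ℝ, E) ∞ G] {T : Subgroup G} (hT : IsTorus E T)
    {X Y : LieAlg E G} (hX : X ∈ subgroupLie E T) (hY : Y ∈ subgroupLie E T) : ⁅X, Y⁆ = 0 := by
  have hc : ∀ x ∈ T, ∀ y ∈ T, x * y = y * x := fun x hx y hy => isTorus_commute hT hx hy
  obtain ⟨γ, hγ, hγT⟩ := (mem_subgroupLie_iff hc).mp hX
  obtain ⟨δ, hδ, hδT⟩ := (mem_subgroupLie_iff hc).mp hY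
  exact lie_eq_zero_of_oneParam_commute hγ hδ fun s t => hc _ (hγT s) _ (hδT t)

/-- Each point of `S` lies on a one-parameter subgroup; by uniqueness it is the one in `T` with the
same generator. -/
theorem torus_le_of_subgroupLie_le [LieGroup 𝓘(ℝ, E) ∞ G] [CompleteSpace E] [T2Space G]
    {S T : Subgroup G} (hS : IsTorus E S) (hT : IsTorus E T)
    (h : subgroupLie E S ≤ subgroupLie E T) : S ≤ T := by
  intro g hg
  obtain ⟨X, γ, hγ, hγS, rfl⟩ := exists_oneParam_of_mem_torus hS hg
  obtain ⟨δ, hδ, hδT⟩ := (mem_subgroupLie_iff fun x hx y hy => isTorus_commute hT hx hy).mp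
    (h (Submodule.subset_span ⟨γ, hγ, hγS⟩))
  rw [hγ.unique hδ]
  exact hδT 1

/-- The centralizer of a regular element of the Lie algebra of a maximal torus is that Lie
algebra. -/
theorem mem_subgroupLie_iff_lie_eq_zero [LieGroup 𝓘(ℝ, E) ∞ G] [CompleteSpace E] [T2Space G]
    {S : Subgroup G} (hS : IsMaximalTorus E S) {Λ : LieAlg E G} (hΛ : Λ ∈ subgroupLie E S)
    (hreg : Λ ∈ regularSet E G) (X : LieAlg E G) : X ∈ subgroupLie E S ↔ ⁅Λ, X⁆ = 0 := by
  obtain ⟨T, hT, hc⟩ := hreg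
  -- Regularity provides some maximal torus `T` whose Lie algebra is the centralizer of `Λ`. It
  -- contains the abelian `Lie(S)`, so maximality of `S` forces `S = T`.
  have hle : subgroupLie E S ≤ subgroupLie E T := fun X hX =>
    (hc X).mpr (lie_eq_zero_of_mem_torus hS.prop hΛ hX)
  have := hS.eq_of_le hT.prop (torus_le_of_subgroupLie_le hS.prop hT.prop hle)
  rw [this]
  exact hc X

end OneParam

/-! ### Linear algebra of an invariant definite form -/

section InvariantForm

variable {L : Type*} [LieRing L] [LieAlgebra ℝ L] (B : LinearMap.BilinForm ℝ L)

/-- A symmetric, negative definite and invariant bilinear form on a Lie algebra. -/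
structure IsNegInvariant : Prop where
  symm : ∀ x y, B x y = B y x
  neg : ∀ x, x ≠ 0 → B x x < 0
  lie : ∀ x y z, B ⁅x, y⁆ z = B x ⁅y, z⁆

variable {B} (hB : IsNegInvariant B) {t : Submodule ℝ L} {lam : L}
include hB

namespace IsNegInvariant

theorem isSymm : B.IsSymm := ⟨hB.symm⟩

theorem eq_zero_of_self {x : L} (h : B x x = 0) : x = 0 := by
  by_contra hx
  exact (hB.neg x hx).ne h

theorem nondegenerate_restrict (s : Submodule ℝ L) : (B.restrict s).Nondegenerate :=
  ⟨fun x hx => Subtype.ext (hB.eq_zero_of_self (hx x)),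
    fun x hx => Subtype.ext (hB.eq_zero_of_self (hx x))⟩

theorem nondegenerate : B.Nondegenerate :=
  ⟨fun x hx => hB.eq_zero_of_self (hx x), fun x hx => hB.eq_zero_of_self (hx x)⟩

theorem isCompl [FiniteDimensional ℝ L] (t : Submodule ℝ L) : IsCompl t (B.orthogonal t) :=
  LinearMap.BilinForm.isCompl_orthogonal_of_restrict_nondegenerate hB.isSymm.isRefl
    (hB.nondegenerate_restrict t)

theorem eq_zero_of_mem_of_mem_orthogonal {x : L} (h1 : x ∈ t) (h2 : x ∈ B.orthogonal t) : x = 0 :=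
  hB.eq_zero_of_self (h2 x h1)

theorem lie_skew (x y z : L) : B ⁅x, y⁆ z = -B y ⁅x, z⁆ := by
  rw [← _root_.lie_skew, ← hB.lie, map_neg, LinearMap.neg_apply]

theorem ext {x y : L} (h : ∀ z, B z x = B z y) : x = y :=
  sub_eq_zero.mp (hB.eq_zero_of_self (by rw [map_sub, h, sub_self]))

/-- `ad lam` is skew, and the image of a skew map is orthogonal to its kernel. -/
theorem lie_mem_orthogonal (ht : ∀ x ∈ t, ⁅lam, x⁆ = 0) (y : L) : ⁅lam, y⁆ ∈ B.orthogonal t := by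
  intro x hx
  have := hB.lie_skew lam x y
  rw [ht x hx, map_zero, LinearMap.zero_apply] at this
  exact neg_eq_zero.mp this.symm

theorem eq_of_lie_eq (hl : ∀ x, x ∈ t ↔ ⁅lam, x⁆ = 0) {x y : L} (hx : x ∈ B.orthogonal t)
    (hy : y ∈ B.orthogonal t) (h : ⁅lam, x⁆ = ⁅lam, y⁆) : x = y :=
  sub_eq_zero.mp (hB.eq_zero_of_mem_of_mem_orthogonal
    ((hl _).mpr (by rw [lie_sub, h, sub_self])) (Submodule.sub_mem _ hx hy))

theorem bijOn [FiniteDimensional ℝ L] (hl : ∀ x, x ∈ t ↔ ⁅lam, x⁆ = 0) :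
    Set.BijOn (fun x => ⁅lam, x⁆) (B.orthogonal t : Set L) (B.orthogonal t) := by
  have hm : ∀ x ∈ B.orthogonal t, LieAlgebra.ad ℝ L lam x ∈ B.orthogonal t := fun x _ =>
    hB.lie_mem_orthogonal (fun x hx => (hl x).mp hx) x
  have hinj : Function.Injective ((LieAlgebra.ad ℝ L lam).restrict hm) := fun x y h =>
    Subtype.ext (hB.eq_of_lie_eq hl x.2 y.2 (congrArg Subtype.val h))
  refine ⟨hm, fun x hx y hy h => hB.eq_of_lie_eq hl hx hy h, fun y hy => ?_⟩
  obtain ⟨x, hx⟩ := LinearMap.injective_iff_surjective.mp hinj ⟨y, hy⟩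
  exact ⟨x, x.2, congrArg Subtype.val hx⟩

/-- The elimination of the components orthogonal to `t` in the canonical bracket. In terms of a
right inverse `r` of `ad lam`, the vectors `ra` and `rb` are `r a` and `r b`. -/
theorem reduced_bracket (hl : ∀ x, x ∈ t ↔ ⁅lam, x⁆ = 0)
    {a a' b b' u v u₀ v₀ ra ra' rb rb' : L}
    (hu : ⁅lam, u⁆ = a' - a) (hv : ⁅lam, v⁆ = b' - b)
    (hu₀ : u₀ ∈ t) (hv₀ : v₀ ∈ t) (huu : u - u₀ ∈ B.orthogonal t) (hvv : v - v₀ ∈ B.orthogonal t)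
    (hra : ra ∈ B.orthogonal t) (hra' : ra' ∈ B.orthogonal t)
    (hrb : rb ∈ B.orthogonal t) (hrb' : rb' ∈ B.orthogonal t)
    (ha : a - ⁅lam, ra⁆ ∈ t) (ha' : a' - ⁅lam, ra'⁆ ∈ t)
    (hb : b - ⁅lam, rb⁆ ∈ t) (hb' : b' - ⁅lam, rb'⁆ ∈ t) :
    B a v - B b u + B lam ⁅u, v⁆ = B a v₀ - B b u₀ + B a' rb' - B a rb := by
  have ht : ∀ x ∈ t, ⁅lam, x⁆ = 0 := fun x hx => (hl x).mp hx
  -- Both `w - w₀` and `rp' - rp` lie in the complement, where `ad lam` is injective. Their images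
  -- differ by an element of `t` that is also orthogonal to `t`, hence agree.
  have hr : ∀ {p p' w w₀ rp rp' : L}, ⁅lam, w⁆ = p' - p → w₀ ∈ t → w - w₀ ∈ B.orthogonal t →
      rp ∈ B.orthogonal t → rp' ∈ B.orthogonal t → p - ⁅lam, rp⁆ ∈ t → p' - ⁅lam, rp'⁆ ∈ t →
      w = w₀ + (rp' - rp) := by
    intro p p' w w₀ rp rp' hw hw₀ hww hrp hrp' hp hp'
    refine eq_add_of_sub_eq' (hB.eq_of_lie_eq hl hww (Submodule.sub_mem _ hrp' hrp) ?_)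
    refine sub_eq_zero.mp (hB.eq_zero_of_mem_of_mem_orthogonal (t := t) ?_ ?_)
    · have e : ⁅lam, w - w₀⁆ - ⁅lam, rp' - rp⁆ = (p' - ⁅lam, rp'⁆) - (p - ⁅lam, rp⁆) := by
        rw [lie_sub, lie_sub, ht _ hw₀, hw]
        abel
      rw [e]
      exact Submodule.sub_mem _ hp' hp
    · exact Submodule.sub_mem _ (hB.lie_mem_orthogonal ht _) (hB.lie_mem_orthogonal ht _)
  -- Antisymmetry of `r`: the complement does not see `t`, so `p` and `q` may be replaced by `⁅lam,
  -- rp⁆` and `⁅lam, rq⁆`.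
  have hskew : ∀ {p q rp rq : L}, rp ∈ B.orthogonal t → rq ∈ B.orthogonal t →
      p - ⁅lam, rp⁆ ∈ t → q - ⁅lam, rq⁆ ∈ t → B p rq = -B q rp := by
    intro p q rp rq hrp hrq hp hq
    have h1 : B (p - ⁅lam, rp⁆) rq = 0 := hrq _ hp
    have h2 : B (q - ⁅lam, rq⁆) rp = 0 := hrp _ hq
    rw [map_sub, LinearMap.sub_apply, sub_eq_zero] at h1 h2
    rw [h1, h2, hB.lie_skew, hB.symm rp]
  have h1 : B lam ⁅u, v⁆ = B (a' - a) (rb' - rb) := by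
    have h0 : B (a' - a) v₀ = 0 := by
      rw [hB.symm, ← hu]
      exact hB.lie_mem_orthogonal ht u v₀ hv₀
    rw [← hB.lie, hu]
    nth_rw 1 [hr hv hv₀ hvv hrb hrb' hb hb']
    rw [map_add, h0, zero_add]
  rw [h1, hr hv hv₀ hvv hrb hrb' hb hb', hr hu hu₀ huu hra hra' ha ha']
  -- Two instances suffice: the terms in `B a rb'` cancel without antisymmetry.
  have h2 := hskew hra hrb ha hb
  have h3 := hskew hra' hrb ha' hb
  simp only [map_add, map_sub, LinearMap.sub_apply]
  linarith

end IsNegInvariant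
end InvariantForm

/-! ### Persistence of regularity along `Lie(G₀)` -/

section Regular

variable {E G : Type*} [NormedAddCommGroup E] [NormedSpace ℝ E] [FiniteDimensional ℝ E]
  [CompleteSpace E] [TopologicalSpace G] [ChartedSpace E G] [Group G] [LieGroup 𝓘(ℝ, E) ∞ G]

/-- The identification of the Lie algebra with the model space. -/
noncomputable def toModel : LieAlg E G →L[ℝ] E where
  toFun X := X
  map_add' _ _ := rfl
  map_smul' _ _ := rfl
  cont := continuous_id (X := E)

/-- The identification of the model space with the Lie algebra. -/
noncomputable def ofModel : E →L[ℝ] LieAlg E G where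
  toFun X := X
  map_add' _ _ := rfl
  map_smul' _ _ := rfl
  cont := continuous_id (X := E)

theorem isNegInvariant_form [T2Space G] [CompactSpace G] [LieAlgebra.IsSimple ℝ (LieAlg E G)]
    {c : ℝ} (hc : 0 < c) : IsNegInvariant (form E G c) where
  symm := form_comm c
  neg := form_neg hc
  lie := form_lie c

/-- Injectivity of `ad` on the complement of `Lie(S)` is an open condition on operators and holds at
`Λ`. While it holds, only `Lie(S)` commutes with the perturbed element, so the same torus `S`
witnesses regularity. -/
theorem eventually_mem_regularSet [T2Space G] {c : ℝ} (hB : IsNegInvariant (form E G c))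
    {S : Subgroup G} (hS : IsMaximalTorus E S) {Λ X : LieAlg E G} (hΛ : Λ ∈ subgroupLie E S)
    (hreg : Λ ∈ regularSet E G) (hX : X ∈ subgroupLie E S) :
    ∀ᶠ s : ℝ in 𝓝 0, Λ + s • X ∈ regularSet E G := by
  have hl := mem_subgroupLie_iff_lie_eq_zero hS hΛ hreg
  let A : ℝ → perp E c S →L[ℝ] E := fun s =>
    (adCLM E G (Λ + s • X : LieAlg E G)).comp (toModel.comp (perp E c S).subtypeL)
  have hA : Continuous A := by
    have h1 : ∀ x y : E, Continuous fun s : ℝ => adCLM E G (x + s • y) := fun x y =>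
      (adCLM E G).continuous.comp (continuous_const.add (continuous_id.smul continuous_const))
    exact (h1 Λ X).clm_comp continuous_const
  have hA0 : Function.Injective (A 0) := by
    intro x y h
    refine Subtype.ext (hB.eq_of_lie_eq hl x.2 y.2 ?_)
    have h' : adCLM E G (Λ + (0 : ℝ) • X : LieAlg E G) x.1
      = adCLM E G (Λ + (0 : ℝ) • X : LieAlg E G) y.1 := h
    rw [zero_smul, add_zero] at h'
    rwa [adCLM_apply, adCLM_apply] at h'
  filter_upwards [hA.continuousAt.eventually
    (ContinuousLinearMap.isOpen_injective.mem_nhds hA0)] with s hs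
  refine ⟨S, hS, fun Y => ⟨fun hY => ?_, fun hY => ?_⟩⟩
  · exact lie_eq_zero_of_mem_torus hS.prop
      (Submodule.add_mem _ hΛ (Submodule.smul_mem _ _ hX)) hY
  · obtain ⟨y, hy, z, hz, rfl⟩ := Submodule.mem_sup.mp
      ((hB.isCompl (subgroupLie E S)).sup_eq_top ▸ Submodule.mem_top : Y ∈ _)
    have hz0 : ⁅Λ + s • X, z⁆ = 0 := by
      rwa [lie_add, lie_eq_zero_of_mem_torus hS.prop
        (Submodule.add_mem _ hΛ (Submodule.smul_mem _ _ hX)) hy, zero_add] at hY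
    have hz1 : A s ⟨z, hz⟩ = A s 0 := by
      rw [map_zero]
      exact (adCLM_apply _ _).trans hz0
    have hz2 : z = 0 := congrArg Subtype.val (hs hz1)
    rwa [hz2, add_zero]

end Regular

/-! ### Gradients of invariant functions and of their restrictions -/

section Gradients

/-- `rep` takes a bare function; `ψ` supplies the linearity that makes the representing vector
exist. -/
theorem apply_rep {V : Type*} [AddCommGroup V] [Module ℝ V] [FiniteDimensional ℝ V]
    {B : LinearMap.BilinForm ℝ V} (hB : B.Nondegenerate) (hs : B.IsSymm) {φ : V → ℝ}
    (ψ : V →ₗ[ℝ] ℝ) (h : ∀ X, φ X = ψ X) (X : V) : B X (rep B φ) = φ X := by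
  obtain rfl : φ = ψ := funext h
  exact (rep_eq_iff B hB hs ψ _).mp rfl X

variable {E G : Type*} [NormedAddCommGroup E] [NormedSpace ℝ E] [FiniteDimensional ℝ E]
  [CompleteSpace E] [TopologicalSpace G] [ChartedSpace E G] [Group G] [LieGroup 𝓘(ℝ, E) ∞ G]
  {c : ℝ}

theorem form_gradL (hB : IsNegInvariant (form E G c)) {V : Type*} (F : G × V → ℝ) (p : G × V)
    (X : LieAlg E G) : form E G c X (gradL c F p)
      = mfderiv 𝓘(ℝ, E) 𝓘(ℝ, ℝ) (fun x : G => F (x * p.1, p.2)) 1 X :=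
  apply_rep hB.nondegenerate hB.isSymm
    (mfderiv 𝓘(ℝ, E) 𝓘(ℝ, ℝ) (fun x : G => F (x * p.1, p.2)) 1).toLinearMap (fun _ => rfl) X

theorem form_gradR (hB : IsNegInvariant (form E G c)) {V : Type*} (F : G × V → ℝ) (p : G × V)
    (X : LieAlg E G) : form E G c X (gradR c F p)
      = mfderiv 𝓘(ℝ, E) 𝓘(ℝ, ℝ) (fun x : G => F (p.1 * x, p.2)) 1 X :=
  apply_rep hB.nondegenerate hB.isSymm
    (mfderiv 𝓘(ℝ, E) 𝓘(ℝ, ℝ) (fun x : G => F (p.1 * x, p.2)) 1).toLinearMap (fun _ => rfl) X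

omit [FiniteDimensional ℝ E] [CompleteSpace E] [LieGroup 𝓘(ℝ, E) ∞ G] in
theorem deriv_line {f : LieAlg E G → ℝ} {Λ : LieAlg E G} (hf : DifferentiableAt ℝ f Λ)
    (X : LieAlg E G) : deriv (fun t : ℝ => f (Λ + t • X)) 0 = fderiv ℝ f Λ X :=
  hf.lineDeriv_eq_fderiv

omit [FiniteDimensional ℝ E] [CompleteSpace E] [LieGroup 𝓘(ℝ, E) ∞ G] in
theorem IsSmoothInvariant.differentiableAt {Φ : G × LieAlg E G → ℝ} (hΦ : IsSmoothInvariant Φ)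
    (g : G) {Λ : LieAlg E G} (hΛ : Λ ∈ regularSet E G) :
    DifferentiableAt ℝ (fun J : LieAlg E G => Φ (g, J)) Λ := by
  rw [← mdifferentiableAt_iff_differentiableAt]
  exact MDifferentiableAt.comp (I' := 𝓘(ℝ, E).prod 𝓘(ℝ, LieAlg E G)) Λ
    ((hΦ.smooth (g, Λ) hΛ).mdifferentiableAt (by simp))
    (mdifferentiableAt_const.prodMk mdifferentiableAt_id)

theorem form_d2 (hB : IsNegInvariant (form E G c)) {Φ : G × LieAlg E G → ℝ}
    (hΦ : IsSmoothInvariant Φ) (g : G) {Λ : LieAlg E G} (hΛ : Λ ∈ regularSet E G)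
    (X : LieAlg E G) : form E G c X (d2 c Φ (g, Λ))
      = fderiv ℝ (fun J : LieAlg E G => Φ (g, J)) Λ X := by
  have h := fun X => deriv_line (hΦ.differentiableAt g hΛ) X
  rw [← h]
  exact apply_rep hB.nondegenerate hB.isSymm
    (fderiv ℝ (fun J : LieAlg E G => Φ (g, J)) Λ).toLinearMap h X

/-- The infinitesimal form of invariance under the adjoint action. -/
theorem lie_d2 (hB : IsNegInvariant (form E G c)) {Φ : G × LieAlg E G → ℝ}
    (hΦ : IsSmoothInvariant Φ) (g : G) {Λ : LieAlg E G} (hΛ : Λ ∈ regularSet E G) :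
    ⁅Λ, d2 c Φ (g, Λ)⁆ = gradR c Φ (g, Λ) - gradL c Φ (g, Λ) := by
  refine hB.ext fun X => ?_
  rw [← hB.lie, map_sub, form_d2 hB hΦ g hΛ, form_gradL hB, form_gradR hB]
  let Q : G × LieAlg E G → ℝ := fun q => Φ (q.1 * g, q.2)
  have hQ : MDifferentiableAt (𝓘(ℝ, E).prod 𝓘(ℝ, LieAlg E G)) 𝓘(ℝ, ℝ) Q (1, Λ) := by
    have h1 : MDifferentiableAt (𝓘(ℝ, E).prod 𝓘(ℝ, LieAlg E G)) 𝓘(ℝ, ℝ) Φ (1 * g, Λ) :=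
      (hΦ.smooth (1 * g, Λ) hΛ).mdifferentiableAt (by simp)
    have h2 : MDifferentiableAt (𝓘(ℝ, E).prod 𝓘(ℝ, LieAlg E G)) 𝓘(ℝ, E)
        (fun q : G × LieAlg E G => q.1 * g) (1, Λ) :=
      MDifferentiableAt.comp (I' := 𝓘(ℝ, E)) (1, Λ) (mdifferentiableAt_mul_right' g 1)
        mdifferentiableAt_fst
    exact MDifferentiableAt.comp (I' := 𝓘(ℝ, E).prod 𝓘(ℝ, LieAlg E G)) (1, Λ) h1
      (h2.prodMk mdifferentiableAt_snd)
  let ev : (E →L[ℝ] E) →L[ℝ] LieAlg E G := (ofModel (E := E) (G := G)).comp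
    (ContinuousLinearMap.apply ℝ E (toModel Λ))
  have hev : HasMFDerivAt 𝓘(ℝ, E) 𝓘(ℝ, LieAlg E G) (fun η : G => ev (AdCLM E η)) 1
      (ev.comp (adCLM E G)) :=
    HasMFDerivAt.comp (1 : G) ev.hasFDerivAt.hasMFDerivAt hasMFDerivAt_AdCLM_one
  have hev1 : ev (AdCLM E (1 : G)) = Λ := by
    rw [AdCLM_one]
    rfl
  have hQ' : HasMFDerivAt (𝓘(ℝ, E).prod 𝓘(ℝ, LieAlg E G)) 𝓘(ℝ, ℝ) Q (1, ev (AdCLM E (1 : G)))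
      (mfderiv (𝓘(ℝ, E).prod 𝓘(ℝ, LieAlg E G)) 𝓘(ℝ, ℝ) Q (1, Λ)) := by
    rw [hev1]
    exact hQ.hasMFDerivAt
  have hcomp := HasMFDerivAt.comp (1 : G) hQ' ((hasMFDerivAt_id (1 : G)).prodMk hev)
  -- Invariance at `(g η, Λ)`: conjugation by `η` sends `g η` to `η g`.
  have hinv : (Q ∘ fun η : G => (id η, ev (AdCLM E η))) = fun η : G => Φ (g * η, Λ) := by
    funext η
    have := hΦ.invariant η (g * η, Λ) hΛ
    rw [← this]
    change Φ (η * g, Ad η Λ) = _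
    simp [mul_assoc]
  rw [hinv] at hcomp
  have h1 := DFunLike.congr_fun hcomp.mfderiv X
  have h2 := mfderiv_prod_eq_add_apply
    (v := ((X, ofModel (adCLM E G X Λ)) : E × LieAlg E G)) hQ
  have h3 : (fun J : LieAlg E G => Q (1, J)) = fun J : LieAlg E G => Φ (g, J) := by
    funext J
    simp only [Q, one_mul]
  have h4 : (ofModel (adCLM E G X Λ) : LieAlg E G) = ⁅X, Λ⁆ := adCLM_apply X Λ
  let dR : ℝ := mfderiv 𝓘(ℝ, E) 𝓘(ℝ, ℝ) (fun η : G => Φ (g * η, Λ)) 1 X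
  let dL : ℝ := mfderiv 𝓘(ℝ, E) 𝓘(ℝ, ℝ) (fun η : G => Φ (η * g, Λ)) 1 X
  -- Chain rule along `η ↦ (η, Ad_η Λ)`, whose second component has derivative `⁅X, Λ⁆`.
  have h5 : dR = dL
      + fderiv ℝ (fun J : LieAlg E G => Q (1, J)) Λ (ofModel (adCLM E G X Λ)) := by
    rw [← mfderiv_eq_fderiv]
    exact h1.trans h2
  rw [h3, h4] at h5
  exact eq_sub_of_add_eq' h5.symm

/-- Near `Λ` on each line in `Lie(S)` the points stay regular, so `F` and `Φ` agree there and have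
the same derivatives in these directions. -/
theorem d2Slice_spec [T2Space G] (hB : IsNegInvariant (form E G c)) {S : Subgroup G}
    (hS : IsMaximalTorus E S) {F : G × subgroupLie E S → ℝ} {Φ : G × LieAlg E G → ℝ}
    (hΦ : IsSmoothInvariant Φ) (hF : IsRestriction S F Φ) (g : G) {Λ : subgroupLie E S}
    (hΛ : (Λ : LieAlg E G) ∈ regularSet E G) :
    d2 c Φ (g, Λ) - d2Slice c S F (g, Λ) ∈ perp E c S := by
  intro X hX
  change form E G c X _ = 0
  have h : ∀ Y : subgroupLie E S, deriv (fun t : ℝ => F (g, Λ + t • Y)) 0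
      = fderiv ℝ (fun J : LieAlg E G => Φ (g, J)) Λ Y := by
    intro Y
    rw [← deriv_line (hΦ.differentiableAt g hΛ)]
    refine Filter.EventuallyEq.deriv_eq ?_
    filter_upwards [eventually_mem_regularSet hB hS Λ.2 hΛ Y.2] with t ht
    exact hF g (Λ + t • Y) ht
  have h2 := apply_rep (hB.nondegenerate_restrict (subgroupLie E S))
    ⟨fun x y => hB.symm x y⟩
    ((fderiv ℝ (fun J : LieAlg E G => Φ (g, J)) Λ).toLinearMap.comp (subgroupLie E S).subtype)
    h ⟨X, hX⟩
  have h3 : form E G c X (d2Slice c S F (g, Λ)) = _ := h2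
  rw [map_sub, form_d2 hB hΦ g hΛ, h3, h, sub_self]

theorem perpPart_spec (hB : IsNegInvariant (form E G c)) (S : Subgroup G) (X : LieAlg E G) :
    perpPart c S X ∈ perp E c S ∧ X - perpPart c S X ∈ subgroupLie E S := by
  refine Classical.epsilon_spec (p := fun Y => Y ∈ perp E c S ∧ X - Y ∈ subgroupLie E S) ?_
  obtain ⟨y, hy, z, hz, h⟩ := Submodule.mem_sup.mp
    ((hB.isCompl (subgroupLie E S)).sup_eq_top ▸ Submodule.mem_top : X ∈ _)
  exact ⟨z, hz, by rwa [← h, add_sub_cancel_right]⟩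

/-- Surjectivity of `ad Λ` on the complement makes the chosen preimage a genuine one; the reduction
uses `r(Λ)` only through these two properties. -/
theorem rMatrix_spec (hB : IsNegInvariant (form E G c)) {S : Subgroup G} {Λ : LieAlg E G}
    (hl : ∀ X, X ∈ subgroupLie E S ↔ ⁅Λ, X⁆ = 0) (X : LieAlg E G) :
    rMatrix c S Λ X ∈ perp E c S ∧ X - ⁅Λ, rMatrix c S Λ X⁆ ∈ subgroupLie E S := by
  have h := perpPart_spec hB S X
  have hm : ∃ Y ∈ (perp E c S : Set (LieAlg E G)), ⁅Λ, Y⁆ = perpPart c S X :=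
    (hB.bijOn hl).surjOn h.1
  have h1 := Function.invFunOn_mem hm
  have h2 : ⁅Λ, rMatrix c S Λ X⁆ = perpPart c S X := Function.invFunOn_eq hm
  rw [h2]
  exact ⟨h1, h.2⟩

end Gradients

end CotangentReduction

/-! ### The reduced bracket -/

theorem theorem2p4 {E G : Type*} [NormedAddCommGroup E] [NormedSpace ℝ E]
    [FiniteDimensional ℝ E] [CompleteSpace E]
    [TopologicalSpace G] [ChartedSpace E G] [Group G] [LieGroup 𝓘(ℝ, E) ∞ G]
    [T2Space G] [CompactSpace G] [SimplyConnectedSpace G] [LieAlgebra.IsSimple ℝ (LieAlg E G)]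
    (c : ℝ) (hc : 0 < c) (G₀ : Subgroup G) (hG₀ : IsMaximalTorus E G₀) :
    -- the inner product is negative definite, and `r(Λ)` is well defined for regular `Λ`
    (∀ X : LieAlg E G, X ≠ 0 → form E G c X X < 0) ∧
    IsCompl (subgroupLie E G₀) (perp E c G₀) ∧
    (∀ Λ ∈ subgroupLie E G₀, Λ ∈ regularSet E G →
      Set.BijOn (fun X : LieAlg E G => ⁅Λ, X⁆) (perp E c G₀) (perp E c G₀)) ∧
    -- the formula for the reduced bracket
    (∀ (F H : G × subgroupLie E G₀ → ℝ) (Φ Ψ : G × LieAlg E G → ℝ),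
      IsSmoothNormalizerInvariant G₀ F → IsSmoothNormalizerInvariant G₀ H →
      IsSmoothInvariant Φ → IsSmoothInvariant Ψ →
      IsRestriction G₀ F Φ → IsRestriction G₀ H Ψ →
      ∀ (g : G) (Λ : subgroupLie E G₀), (Λ : LieAlg E G) ∈ regularSet E G →
        poissonBracket c Φ Ψ (g, Λ) =
          form E G c (gradL c F (g, Λ)) (d2Slice c G₀ H (g, Λ))
          - form E G c (gradL c H (g, Λ)) (d2Slice c G₀ F (g, Λ))
          + form E G c (gradR c F (g, Λ)) (rMatrix c G₀ Λ (gradR c H (g, Λ)))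
          - form E G c (gradL c F (g, Λ)) (rMatrix c G₀ Λ (gradL c H (g, Λ)))) := by
  have hB : IsNegInvariant (form E G c) := isNegInvariant_form hc
  refine ⟨hB.neg, hB.isCompl _, fun Λ hΛ hreg =>
    hB.bijOn (mem_subgroupLie_iff_lie_eq_zero hG₀ hΛ hreg), ?_⟩
  intro F H Φ Ψ _ _ hΦ hΨ hF hH g Λ hreg
  have hl := mem_subgroupLie_iff_lie_eq_zero hG₀ Λ.2 hreg
  -- Translations of `g` leave `Λ` fixed, so `F` and `Φ` agree along them and share their
  -- first-variable gradients.
  have eL : ∀ {F : G × subgroupLie E G₀ → ℝ} {Φ : G × LieAlg E G → ℝ}, IsRestriction G₀ F Φ →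
      gradL (E := E) c F (g, Λ) = gradL c Φ (g, (Λ : LieAlg E G)) := by
    intro F Φ h
    have e : (fun x : G => F (x * g, Λ)) = fun x : G => Φ (x * g, (Λ : LieAlg E G)) :=
      funext fun x => h _ Λ hreg
    exact congrArg (fun f : G → ℝ =>
      rep (form E G c) fun X => (mfderiv 𝓘(ℝ, E) 𝓘(ℝ, ℝ) f 1 X : ℝ)) e
  have eR : ∀ {F : G × subgroupLie E G₀ → ℝ} {Φ : G × LieAlg E G → ℝ}, IsRestriction G₀ F Φ →
      gradR (E := E) c F (g, Λ) = gradR c Φ (g, (Λ : LieAlg E G)) := by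
    intro F Φ h
    have e : (fun x : G => F (g * x, Λ)) = fun x : G => Φ (g * x, (Λ : LieAlg E G)) :=
      funext fun x => h _ Λ hreg
    exact congrArg (fun f : G → ℝ =>
      rep (form E G c) fun X => (mfderiv 𝓘(ℝ, E) 𝓘(ℝ, ℝ) f 1 X : ℝ)) e
  rw [eL hF, eL hH, eR hF, eR hH]
  have r := rMatrix_spec (Λ := (Λ : LieAlg E G)) hB hl
  exact hB.reduced_bracket hl (lie_d2 hB hΦ g hreg) (lie_d2 hB hΨ g hreg)
    (d2Slice c G₀ F (g, Λ)).2 (d2Slice c G₀ H (g, Λ)).2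
    (d2Slice_spec hB hG₀ hΦ hF g hreg) (d2Slice_spec hB hG₀ hΨ hH g hreg)
    (r _).1 (r (gradR c Φ (g, (Λ : LieAlg E G)))).1 (r _).1 (r _).1
    (r _).2 (r _).2 (r _).2 (r _).2
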